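/- **Definitions.** An element of a poset with least element $\bot$ is *basic* if it is $\bot$ or an atom; $x\lessdot w$ means that $w$ covers $x$. A *Boolean domain* is a poset isomorphic to the lattice $\mathrm{Sub}(B)$ of Boolean subalgebras of some Boolean algebra $B$, ordered by inclusion. An element $x$ of a lattice is *dual modular* if $(x\vee y)\wedge z=x\vee(y\wedge z)$ whenever $x\le z$, and $(w\vee x)\wedge y=w\vee(x\wedge y)$ whenever $w\le y$. A *principal pair* of a Boolean domain is an ordered pair $(y,z)$ of dual modular elements such that (i) $y=\top$ and $z$ is basic, or (ii) $z=\top$ and $y$ is basic, or (iii) $y\vee z=\top$ and $y\wedge z$ is basic and not dual modular; it is a principal pair *for* $x$ if $y\wedge z=x$. An *orthodomain* is a poset $X$ with least element $\bot$ such that: every nonempty directed subset has a join; $X$ is atomistic and its atoms are compact; every principal ideal $\downarrow x$ is a Boolean domain; and if $x\neq y$ are atoms with $x,y\lessdot w$, then $w=x\vee y$. A *direction* for a basic element $x\in X$ is a map $d:\uparrow x\to X^2$ such that for all $y,z\ge x$: (1) $d(y)$ is a principal pair for $x$ in $\downarrow y$; (2) if $y\le z$ and $d(z)=(v,w)$,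 then $d(y)=(y\wedge v,y\wedge w)$; (3) if $x\lessdot y,z$ and $d(y)=(x,y)$, $d(z)=(z,x)$, then $y\vee z$ exists and $y,z\lessdot y\vee z$. Let $\mathrm{oDir}(X)$ be the set of directions for all basic elements of $X$. The orthodomain $X$ is *proper* if no maximal element is basic, and it *has enough directions* if it is proper and every basic element has a direction. For a direction $d$ for $x$, let $d'$ be the direction for $x$ with $d'(w)=(z,y)$ if $d(w)=(y,z)$; let $0,1$ be the directions for $\bot$ with $0(w)=(\bot,w)$ and $1(w)=(w,\bot)$. Two atoms $x\ne y$ are *near* if $w=x\vee y$ exists and $x,y\lessdot w$. The partial operation $\oplus$ on $\mathrm{oDir}(X)$ is defined exactly in the following cases: $d\oplus 0=d=0\oplus d$; $d\oplus d'=1$; and if $d$ is a direction for $x$ and $e$ a direction for $y$, where $x,y$ are near with $w=x\vee y$, $d(w)=(x,w)$ and $e(w)=(y,w)$, then $d\oplus e$ is the direction for $z$ with $(d\oplus e)(w)=(w,z)$, where $z$ is the third atom beneath $w$. An *orthoalgebra* is a set $A$ with a partial binary operation $\oplus$, a unary operation $'$ and constants $0,1$ such that $\oplus$ is commutative and associative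 (if one side of the law is defined, so is the other, and they are equal), $a'$ is the unique element with $a\oplus a'$ defined and equal to $1$, and $a\oplus a$ is defined if and only if $a=0$. A *Boolean subalgebra* of $A$ is a subset containing $0,1$, closed under $'$ and under existing sums, whose induced structure arises from a Boolean algebra by restricting the join to pairs of orthogonal elements. The orthoalgebra $A$ is *proper* if none of its maximal Boolean subalgebras has four or fewer elements. **Theorem.** If $X$ is an orthodomain with enough directions, then the partial operation $\oplus$ on $\mathrm{oDir}(X)$ is well defined, and $\mathrm{oDir}(X)$ with $\oplus$, $'$, $0$, $1$ is a proper orthoalgebra. -/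

import Mathlib

universe u

section BooleanDomains

/-- A *Boolean domain*: a poset isomorphic to the lattice of Boolean subalgebras of some
Boolean algebra, ordered by inclusion. -/
def IsBooleanDomain (L : Type u) [PartialOrder L] : Prop :=
  ∃ (B : Type u) (_ : BooleanAlgebra B), Nonempty (L ≃o BooleanSubalgebra B)

/-- An element of a poset with least element is *basic* if it is the least element or an atom. -/
def IsBasic {L : Type u} [PartialOrder L] [OrderBot L] (x : L) : Prop :=
  x = ⊥ ∨ IsAtom x

/-- *Dual modular* elements. In a lattice this says
`(x ⊔ y) ⊓ z = x ⊔ (y ⊓ z)` whenever `x ≤ z`, and `(w ⊔ x) ⊓ y = w ⊔ (x ⊓ y)` whenever `w ≤ y`.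
Joins and meets are expressed by `IsLUB` and `IsGLB`: the lattices in question are principal
ideals of a poset and carry no chosen lattice operations. -/
def IsDualModular {L : Type u} [PartialOrder L] (x : L) : Prop :=
  (∀ y z j m t : L, x ≤ z → IsLUB {x, y} j → IsGLB {y, z} m → IsGLB {j, z} t →
    IsLUB {x, m} t) ∧
  (∀ w y j m t : L, w ≤ y → IsLUB {w, x} j → IsGLB {x, y} m → IsGLB {j, y} t →
    IsLUB {w, m} t)

/-- *Principal pairs* of a Boolean domain. -/
def IsPrincipalPair {L : Type u} [PartialOrder L] [OrderBot L] [OrderTop L] (p : L × L) : Prop :=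
  IsDualModular p.1 ∧ IsDualModular p.2 ∧
    ((p.1 = ⊤ ∧ IsBasic p.2) ∨
     (p.2 = ⊤ ∧ IsBasic p.1) ∨
     (IsLUB {p.1, p.2} ⊤ ∧ ∃ m : L, IsGLB {p.1, p.2} m ∧ IsBasic m ∧ ¬ IsDualModular m))

/-- `p` is a principal pair *for* `x` if moreover the meet of its components is `x`. -/
def IsPrincipalPairFor {L : Type u} [PartialOrder L] [OrderBot L] [OrderTop L]
    (x : L) (p : L × L) : Prop :=
  IsPrincipalPair p ∧ IsGLB {p.1, p.2} x

end BooleanDomains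

section Orthodomains

/-- *Orthodomains*. -/
structure IsOrthodomain (X : Type u) [PartialOrder X] [OrderBot X] : Prop where
  exists_directed_join : ∀ D : Set X, D.Nonempty → DirectedOn (· ≤ ·) D → ∃ s, IsLUB D s
  atomistic : IsAtomistic X
  compact_of_atom : ∀ x : X, IsAtom x → IsCompactElement x
  booleanDomain_Iic : ∀ x : X, IsBooleanDomain (Set.Iic x)
  isLUB_of_covBy : ∀ x y w : X, IsAtom x → IsAtom y → x ≠ y → x ⋖ w → y ⋖ w → IsLUB {x, y} w

/-- A *direction* of `X`: a basic element `base` together with a map from the principal filter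
of `base` to `X × X`. (Meets of elements below `z` are the same in `X` and in the principal
ideal of `z`.) -/
@[ext]
structure Direction (X : Type u) [PartialOrder X] [OrderBot X] where
  base : X
  isBasic_base : IsBasic base
  toFun : Set.Ici base → X × X
  /-- `d(y)` is a principal pair for `base` in the principal ideal of `y`. -/
  principal : ∀ y : Set.Ici base,
    ∃ (h₁ : (toFun y).1 ≤ (y : X)) (h₂ : (toFun y).2 ≤ (y : X)),
      IsPrincipalPairFor (L := Set.Iic (y : X)) ⟨base, y.2⟩ (⟨(toFun y).1, h₁⟩, ⟨(toFun y).2, h₂⟩)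
  /-- If `y ≤ z` and `d(z) = (v, w)` then `d(y) = (y ∧ v, y ∧ w)`. -/
  restrict : ∀ y z : Set.Ici base, y ≤ z →
    IsGLB {(y : X), (toFun z).1} (toFun y).1 ∧ IsGLB {(y : X), (toFun z).2} (toFun y).2
  /-- If `base` is covered by `y, z`, `d(y) = (base, y)` and `d(z) = (z, base)`, then the join
  of `y` and `z` exists and covers both. -/
  exists_join : ∀ y z : Set.Ici base, base ⋖ (y : X) → base ⋖ (z : X) →
    toFun y = (base, (y : X)) → toFun z = ((z : X), base) →
      ∃ j : X, IsLUB {(y : X), (z : X)} j ∧ (y : X) ⋖ j ∧ (z : X) ⋖ j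

/-- An orthodomain is *proper* if no basic element is maximal. -/
def IsProperOrthodomain (X : Type u) [PartialOrder X] [OrderBot X] : Prop :=
  ∀ x : X, IsBasic x → ¬ IsMax x

/-- *Enough directions*: proper, and every basic element has a direction. -/
def HasEnoughDirections (X : Type u) [PartialOrder X] [OrderBot X] : Prop :=
  IsProperOrthodomain X ∧ ∀ x : X, IsBasic x → ∃ d : Direction X, d.base = x

/-- Atoms `x, y` are *near*, with join `w`: they are distinct and their join is `w`, which covers
both. -/
def IsNearWithJoin {X : Type u} [PartialOrder X] [OrderBot X] (x y w : X) : Prop :=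
  IsAtom x ∧ IsAtom y ∧ x ≠ y ∧ IsLUB {x, y} w ∧ x ⋖ w ∧ y ⋖ w

/-- `z` is a third atom beneath `w`, besides `x` and `y`. -/
def IsThirdAtom {X : Type u} [PartialOrder X] [OrderBot X] (x y w z : X) : Prop :=
  IsAtom z ∧ z ≠ x ∧ z ≠ y ∧ z ≤ w

namespace Direction

variable {X : Type u} [PartialOrder X] [OrderBot X]

/-- `d.Value w p`: the direction `d` is defined at `w` and `d(w) = p`. -/
def Value (d : Direction X) (w : X) (p : X × X) : Prop :=
  ∃ h : d.base ≤ w, d.toFun ⟨w, h⟩ = p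

theorem isDualModular_bot {L : Type u} [PartialOrder L] [OrderBot L] :
    IsDualModular (⊥ : L) := by
  refine ⟨fun y z j m t _ hj hm ht => ?_, fun w y j m t hwy hj hm ht => ?_⟩
  · have hjy : j = y := hj.unique (by simp [IsLUB, IsLeast, upperBounds, lowerBounds])
    subst hjy
    obtain rfl := ht.unique hm
    simp [IsLUB, IsLeast, upperBounds, lowerBounds]
  · have hjw : j = w := hj.unique (by simp [IsLUB, IsLeast, upperBounds, lowerBounds])
    subst hjw
    have htj : t = j := ht.unique ⟨by simp [lowerBounds, hwy], fun a ha => ha (by simp)⟩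
    have hmb : m = ⊥ := le_bot_iff.1 (hm.1 (by simp))
    subst htj hmb
    simp [IsLUB, IsLeast, upperBounds, lowerBounds]

theorem isDualModular_top {L : Type u} [PartialOrder L] [OrderTop L] :
    IsDualModular (⊤ : L) := by
  refine ⟨fun y z j m t hz hj hm ht => ?_, fun w y j m t hwy hj hm ht => ?_⟩
  · have hj' : j = ⊤ := top_le_iff.1 (hj.1 (by simp))
    have hz' : z = ⊤ := top_le_iff.1 hz
    subst hj' hz'
    have ht' : t = ⊤ := top_le_iff.1 (ht.2 (by simp [lowerBounds]))
    subst ht'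
    exact ⟨by simp [upperBounds], fun a ha => ha (by simp)⟩
  · have hj' : j = ⊤ := top_le_iff.1 (hj.1 (by simp))
    subst hj'
    have hty : t = y := ht.unique ⟨by simp [lowerBounds], fun a ha => ha (by simp)⟩
    have hmy : m = y := hm.unique ⟨by simp [lowerBounds], fun a ha => ha (by simp)⟩
    subst hty hmy
    exact ⟨by simp [upperBounds, hwy], fun a ha => ha (by simp)⟩

theorem isPrincipalPairFor_swap {L : Type u} [PartialOrder L] [OrderBot L] [OrderTop L]
    {x a b : L} (h : IsPrincipalPairFor x (a, b)) : IsPrincipalPairFor x (b, a) := by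
  obtain ⟨⟨h₁, h₂, h₃⟩, h₄⟩ := h
  refine ⟨⟨h₂, h₁, ?_⟩, by simpa [Set.pair_comm] using h₄⟩
  rcases h₃ with h | h | h
  · exact Or.inr (Or.inl h)
  · exact Or.inl h
  · exact Or.inr (Or.inr (by simpa [Set.pair_comm] using h))

theorem isPrincipalPairFor_bot_top {L : Type u} [PartialOrder L] [OrderBot L] [OrderTop L] :
    IsPrincipalPairFor (⊥ : L) (⊥, ⊤) :=
  ⟨⟨isDualModular_bot, isDualModular_top, Or.inr (Or.inl ⟨rfl, Or.inl rfl⟩)⟩,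
    by simp [IsGLB, IsGreatest, upperBounds, lowerBounds]⟩

/-- The direction `d'` with the same base, `d'(w) = (z, y)` if `d(w) = (y, z)`. -/
def compl (d : Direction X) : Direction X where
  base := d.base
  isBasic_base := d.isBasic_base
  toFun w := (d.toFun w).swap
  principal y := by
    obtain ⟨h₁, h₂, h⟩ := d.principal y
    exact ⟨h₂, h₁, isPrincipalPairFor_swap h⟩
  restrict y z hyz := (d.restrict y z hyz).symm
  exists_join y z hy hz h₁ h₂ := by
    obtain ⟨j, hj, hyj, hzj⟩ := d.exists_join z y hz hy
      (Prod.swap_injective h₂) (Prod.swap_injective h₁)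
    exact ⟨j, by rwa [Set.pair_comm], hzj, hyj⟩

/-- The direction `0` for `⊥`, given by `0(w) = (⊥, w)`. -/
def zero : Direction X where
  base := ⊥
  isBasic_base := Or.inl rfl
  toFun w := (⊥, (w : X))
  principal _ := ⟨bot_le, le_rfl, isPrincipalPairFor_bot_top⟩
  restrict y z hyz := by
    have h : (y : X) ≤ (z : X) := hyz
    exact ⟨⟨by simp [lowerBounds], fun a ha => ha (by simp)⟩,
      ⟨by simp [lowerBounds, h], fun a ha => ha (by simp)⟩⟩
  exists_join _ _ _ hz _ h₂ := absurd (congrArg Prod.fst h₂) hz.lt.ne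

/-- The direction `1` for `⊥`, given by `1(w) = (w, ⊥)`. -/
def one : Direction X where
  base := ⊥
  isBasic_base := Or.inl rfl
  toFun w := ((w : X), ⊥)
  principal _ := ⟨le_rfl, bot_le, isPrincipalPairFor_swap isPrincipalPairFor_bot_top⟩
  restrict y z hyz := (zero.restrict y z hyz).symm
  exists_join _ _ hy _ h₁ _ := absurd (congrArg Prod.fst h₁) hy.lt.ne'

/-- The hypothesis under which the third clause defines the sum of `d` and `e`: their bases `x`
and `y` are near with join `w`, `d(w) = (x, w)` and `e(w) = (y, w)`. -/
def NearAt (d e : Direction X) (w : X) : Prop :=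
  IsNearWithJoin d.base e.base w ∧ d.Value w (d.base, w) ∧ e.Value w (e.base, w)

/-- The domain of definition of the partial sum of directions. -/
def Orthogonal (d e : Direction X) : Prop :=
  d = zero ∨ e = zero ∨ e = d.compl ∨ ∃ w, NearAt d e w

/-- `IsSum d e f`: one of the clauses defining the partial sum gives `d` plus `e` the value `f`. -/
def IsSum (d e f : Direction X) : Prop :=
  (e = zero ∧ f = d) ∨ (d = zero ∧ f = e) ∨ (e = d.compl ∧ f = one) ∨
    ∃ w z, NearAt d e w ∧ IsThirdAtom d.base e.base w z ∧ f.base = z ∧ f.Value w (w, z)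

end Direction

end Orthodomains

section Orthoalgebras

/-- *Orthoalgebras*. The partial operation takes values in `Part A`, so that equality of two
expressions means: if one side is defined then so is the other, and they are equal. -/
structure Orthoalgebra (A : Type u) where
  oplus : A → A → Part A
  compl : A → A
  zero : A
  one : A
  oplus_comm : ∀ a b, oplus a b = oplus b a
  oplus_assoc : ∀ a b c,
    ((oplus a b).bind fun s => oplus s c) = ((oplus b c).bind fun s => oplus a s)
  oplus_compl : ∀ a, one ∈ oplus a (compl a)
  eq_compl : ∀ a b, one ∈ oplus a b → b = compl a
  oplus_self_dom : ∀ a, (oplus a a).Dom ↔ a = zero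

namespace Orthoalgebra

variable {A : Type u} (O : Orthoalgebra A)

/-- *Subalgebras* of an orthoalgebra. -/
structure IsSubalgebra (S : Set A) : Prop where
  zero_mem : O.zero ∈ S
  one_mem : O.one ∈ S
  compl_mem : ∀ a ∈ S, O.compl a ∈ S
  oplus_mem : ∀ a ∈ S, ∀ b ∈ S, ∀ c ∈ O.oplus a b, c ∈ S

/-- *Boolean subalgebras*: subalgebras whose orthoalgebra structure arises from a Boolean algebra
by restricting the join to pairs of orthogonal (that is, disjoint) elements. -/
def IsBooleanSubalgebra (S : Set A) : Prop :=
  O.IsSubalgebra S ∧ ∃ _ : BooleanAlgebra S,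
    ((⊥ : S) : A) = O.zero ∧ ((⊤ : S) : A) = O.one ∧
    (∀ a : S, ((aᶜ : S) : A) = O.compl a) ∧
    ∀ a b c : S, (c : A) ∈ O.oplus a b ↔ Disjoint a b ∧ a ⊔ b = c

/-- *Blocks*: maximal Boolean subalgebras. -/
def IsBlock (S : Set A) : Prop :=
  Maximal O.IsBooleanSubalgebra S

/-- An orthoalgebra is *proper* if it has no small block, i.e. no block with at most four
elements. -/
def IsProper : Prop :=
  ∀ S : Set A, O.IsBlock S → ¬ S.encard ≤ 4

end Orthoalgebra

end Orthoalgebras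

/-! A direction is a way of choosing an element from each Boolean algebra that `X` describes,
coherently in the algebra. For `t` with `↓t ≅ Sub(B)`, a basic element below `t` is a subalgebra
`{⊥, ⊤, p, pᶜ}`, which remembers `p` only up to complement. Its principal pairs are exactly
`(principal p, principal pᶜ)` and the swap of this pair (`eq_principal_of_isPrincipalPairFor`), so
the value of a direction at `t` chooses between `p` and `pᶜ`. If `t` is not basic, `B` has more than
four elements and the pair determines `p` (`eq_of_principal_eq`).

Two facts make this a bijection between `B` and the directions with base below `t`. Existence comes
from having enough directions, after passing to `d'` if the wrong orientation was given. Uniqueness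
is rigidity: one value above the base determines a direction (`Direction.eq_of_value`). Restriction
moves an orientation down to covers of the base, and condition (3) moves it from one cover to
another by placing oppositely oriented covers under a common element.

Under the bijection, `⊕` is the join of disjoint elements of `B` (`Represents.isSum_iff`).
Well-definedness and the laws are then computed in a single `B`, once all directions involved have
base below one `t`. For associativity this is the only difficulty: if both sums come from near
atoms, at `w` and at `w'`, the inner sum is oppositely oriented at these two covers of its base, and
condition (3) supplies `t`.

For properness, a block with at most four elements has all its bases in `{⊥, x}` with `x` basic. It
then lies in the Boolean subalgebra of directions with base below some nonbasic `t ≥ x`; maximality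
makes the two equal, and atomisticity forces `t = x`. -/

/-! ### Dual modular elements and principal pairs in the lattice of subalgebras. -/

section BooleanSubalgebras

variable {B : Type u} [BooleanAlgebra B]

namespace BooleanSubalgebra

/-- The Boolean subalgebra of all elements below `p` together with their complements. -/
def principal (p : B) : BooleanSubalgebra B where
  carrier := {b | b ≤ p ∨ pᶜ ≤ b}
  supClosed' := by
    rintro a (ha | ha) b (hb | hb)
    · exact Or.inl (sup_le ha hb)
    · exact Or.inr (le_sup_of_le_right hb)
    · exact Or.inr (le_sup_of_le_left ha)
    · exact Or.inr (le_sup_of_le_left ha)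
  infClosed' := by
    rintro a (ha | ha) b (hb | hb)
    · exact Or.inl (inf_le_of_left_le ha)
    · exact Or.inl (inf_le_of_left_le ha)
    · exact Or.inl (inf_le_of_right_le hb)
    · exact Or.inr (le_inf ha hb)
  compl_mem' := by
    rintro a (ha | ha)
    · exact Or.inr (compl_le_compl ha)
    · exact Or.inl (compl_le_iff_compl_le.1 ha)
  bot_mem' := Or.inl bot_le

theorem mem_principal {p b : B} : b ∈ principal p ↔ b ≤ p ∨ pᶜ ≤ b := Iff.rfl

theorem mem_principal_compl {p b : B} : b ∈ principal pᶜ ↔ b ≤ pᶜ ∨ p ≤ b := by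
  rw [mem_principal, compl_compl]

theorem principal_bot : principal (⊥ : B) = ⊥ := by
  refine SetLike.ext fun b => ?_
  simp [mem_principal]

theorem principal_top : principal (⊤ : B) = ⊤ := by
  refine SetLike.ext fun b => ?_
  simp [mem_principal]

theorem mem_closure_self (p : B) : p ∈ closure {p} := subset_closure rfl

theorem eq_of_mem_principal {p b : B} (h₁ : b ∈ principal p) (h₂ : b ∈ principal pᶜ) :
    b = ⊥ ∨ b = ⊤ ∨ b = p ∨ b = pᶜ := by
  rw [mem_principal] at h₁
  rw [mem_principal_compl] at h₂
  rcases h₁ with h₁ | h₁ <;> rcases h₂ with h₂ | h₂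
  · exact Or.inl (le_bot_iff.1 (inf_compl_eq_bot (a := p) ▸ le_inf h₁ h₂))
  · exact Or.inr (Or.inr (Or.inl (le_antisymm h₁ h₂)))
  · exact Or.inr (Or.inr (Or.inr (le_antisymm h₂ h₁)))
  · exact Or.inr (Or.inl (top_le_iff.1 (sup_compl_eq_top (x := p) ▸ sup_le h₂ h₁)))

theorem closure_le_principal_inf (p : B) : closure {p} ≤ principal p ⊓ principal pᶜ := by
  rw [closure_le, Set.singleton_subset_iff]
  exact ⟨Or.inl le_rfl, mem_principal_compl.2 (Or.inr le_rfl)⟩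

theorem mem_closure_singleton {p b : B} :
    b ∈ closure {p} ↔ b = ⊥ ∨ b = ⊤ ∨ b = p ∨ b = pᶜ := by
  constructor
  · exact fun hb => eq_of_mem_principal (closure_le_principal_inf p hb).1
      (closure_le_principal_inf p hb).2
  · have hp := mem_closure_self p
    rintro (rfl | rfl | rfl | rfl)
    exacts [bot_mem, top_mem, hp, compl_mem hp]

theorem closure_compl (p : B) : closure {pᶜ} = closure {p} := by
  refine SetLike.ext fun b => ?_
  simp only [mem_closure_singleton, compl_compl]
  tauto

theorem principal_inf_principal_compl (p : B) :
    principal p ⊓ principal pᶜ = closure {p} :=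
  le_antisymm (fun _ hb => mem_closure_singleton.2 (eq_of_mem_principal hb.1 hb.2))
    (closure_le_principal_inf p)

theorem closure_singleton_eq_bot {p : B} : closure {p} = ⊥ ↔ p = ⊥ ∨ p = ⊤ := by
  rw [← le_bot_iff, closure_le, Set.singleton_subset_iff, SetLike.mem_coe, mem_bot]

theorem closure_le_of_mem {p : B} {S : BooleanSubalgebra B} (h : p ∈ S) : closure {p} ≤ S := by
  rwa [closure_le, Set.singleton_subset_iff]

theorem closure_singleton_eq {p q : B} (hp : closure {p} ≠ ⊥) (h : p ∈ closure {q}) :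
    closure {p} = closure {q} := by
  rw [mem_closure_singleton] at h
  rw [Ne, closure_singleton_eq_bot] at hp
  rcases h with h | h | rfl | rfl
  · exact absurd (Or.inl h) hp
  · exact absurd (Or.inr h) hp
  · rfl
  · exact closure_compl q

theorem isBasic_iff {S : BooleanSubalgebra B} : IsBasic S ↔ ∃ p, S = closure {p} := by
  constructor
  · rintro (rfl | h)
    · exact ⟨⊥, (closure_singleton_eq_bot.2 (Or.inl rfl)).symm⟩
    · obtain ⟨p, hp, hp'⟩ := SetLike.exists_of_lt h.bot_lt
      refine ⟨p, ?_⟩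
      by_contra hne
      have := h.2 _ (lt_of_le_of_ne (closure_le_of_mem hp) (Ne.symm hne))
      rw [closure_singleton_eq_bot] at this
      exact hp' this
  · rintro ⟨p, rfl⟩
    by_cases hp : closure {p} = ⊥
    · exact Or.inl hp
    · refine Or.inr ⟨hp, fun S hS => ?_⟩
      by_contra hne
      obtain ⟨q, hq, hq'⟩ := SetLike.exists_of_lt (bot_lt_iff_ne_bot.2 hne)
      have h₁ : closure {q} = closure {p} :=
        closure_singleton_eq (fun h => hq' (h ▸ mem_closure_self q)) (hS.le hq)
      exact hS.not_ge (h₁ ▸ closure_le_of_mem hq)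

/-- Every element of a dual modular subalgebra bounds, up to complement, a principal ideal contained
in the subalgebra. -/
theorem le_mem_or_le_compl_mem {S : BooleanSubalgebra B} (hS : IsDualModular S) {s : B}
    (hs : s ∈ S) : (∀ b ≤ s, b ∈ S) ∨ ∀ b ≤ sᶜ, b ∈ S := by
  by_contra! hcon
  obtain ⟨⟨b, hbs, hb⟩, c, hcs, hc⟩ := hcon
  have hbc : b ⊓ c = ⊥ :=
    le_bot_iff.1 ((inf_le_inf hbs hcs).trans_eq inf_compl_eq_bot)
  have hsb : s ⊓ (b ⊔ c) = b := by
    rw [inf_sup_left, inf_eq_right.2 hbs,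
      le_bot_iff.1 ((inf_le_inf_left s hcs).trans_eq inf_compl_eq_bot), sup_bot_eq]
  have hsc : sᶜ ⊓ (b ⊔ c) = c := by
    rw [inf_sup_left, inf_eq_right.2 hcs,
      le_bot_iff.1 ((inf_le_inf_left sᶜ hbs).trans_eq compl_inf_eq_bot), bot_sup_eq]
  have hne : b ⊔ c ∉ S := fun h => hb (hsb ▸ inf_mem hs h)
  -- The modular law for `W ≤ Y` fails: `W ⊔ (S ⊓ Y)` collapses to `W`, while `(W ⊔ S) ⊓ Y` contains
  -- `b = s ⊓ (b ⊔ c)`.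
  let W : BooleanSubalgebra B := closure {b ⊔ c}
  let Y : BooleanSubalgebra B := closure {b} ⊔ closure {c}
  have hbY : b ∈ Y := (le_sup_left : closure {b} ≤ Y) (mem_closure_self b)
  have hcY : c ∈ Y := (le_sup_right : closure {c} ≤ Y) (mem_closure_self c)
  have hWY : W ≤ Y := closure_le_of_mem (sup_mem hbY hcY)
  have key := (hS.2 W Y (W ⊔ S) (S ⊓ Y) ((W ⊔ S) ⊓ Y) hWY isLUB_pair isGLB_pair isGLB_pair).unique
    isLUB_pair
  have hYb : Y ≤ principal bᶜ := sup_le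
    (closure_le_of_mem (mem_principal_compl.2 (Or.inr le_rfl)))
    (closure_le_of_mem (mem_principal_compl.2 (Or.inl
      (le_compl_iff_disjoint_left.2 (disjoint_iff.2 hbc)))))
  have hYc : Y ≤ principal cᶜ := sup_le
    (closure_le_of_mem (mem_principal_compl.2 (Or.inl
      (le_compl_iff_disjoint_right.2 (disjoint_iff.2 hbc)))))
    (closure_le_of_mem (mem_principal_compl.2 (Or.inr le_rfl)))
  have hYbc : Y ≤ principal (b ⊔ c) := sup_le
    (closure_le_of_mem (Or.inl le_sup_left)) (closure_le_of_mem (Or.inl le_sup_right))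
  -- Up to complement the members of `Y` are `⊥`, `b`, `c` and `b ⊔ c`, and the last three are not
  -- in `S`. The three inclusions of `Y` into principal subalgebras replace a description of `Y`.
  have hSY : S ⊓ Y ≤ ⊥ := by
    rintro x ⟨hxS, hxY⟩
    have low : ∀ x ∈ S, x ∈ Y → x ≤ b ⊔ c → x = ⊥ := by
      intro x hxS hxY hx
      rcases mem_principal_compl.1 (hYb hxY) with h₁ | h₁ <;>
      rcases mem_principal_compl.1 (hYc hxY) with h₂ | h₂
      · have : x ≤ (b ⊔ c)ᶜ := by rw [compl_sup]; exact le_inf h₁ h₂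
        exact le_bot_iff.1 ((le_inf hx this).trans_eq inf_compl_eq_bot)
      · refine absurd ?_ hc
        have : x ≤ c := by
          calc x ≤ (b ⊔ c) ⊓ bᶜ := le_inf hx h₁
            _ = c ⊓ bᶜ := by rw [inf_sup_right, inf_compl_eq_bot, bot_sup_eq]
            _ ≤ c := inf_le_left
        rwa [← le_antisymm this h₂]
      · refine absurd ?_ hb
        have : x ≤ b := by
          calc x ≤ (b ⊔ c) ⊓ cᶜ := le_inf hx h₂
            _ = b ⊓ cᶜ := by rw [inf_sup_right, inf_compl_eq_bot, sup_bot_eq]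
            _ ≤ b := inf_le_left
        rwa [← le_antisymm this h₁]
      · refine absurd ?_ hne
        rwa [← le_antisymm hx (sup_le h₁ h₂)]
    rcases hYbc hxY with h | h
    · exact Or.inl (low x hxS hxY h)
    · have := low xᶜ (compl_mem hxS) (compl_mem hxY) (compl_le_iff_compl_le.1 h)
      exact Or.inr (compl_eq_bot.1 this)
  have hbW : b ∈ W := by
    have h₁ : b ∈ (W ⊔ S) ⊓ Y := by
      refine ⟨?_, hbY⟩
      have h₂ : s ⊓ (b ⊔ c) ∈ W ⊔ S := inf_mem ((le_sup_right : S ≤ W ⊔ S) hs)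
        ((le_sup_left : W ≤ W ⊔ S) (mem_closure_self _))
      rwa [hsb] at h₂
    rw [key, le_bot_iff.1 hSY, sup_bot_eq] at h₁
    exact h₁
  rcases mem_closure_singleton.1 hbW with h | h | h | h
  · exact hb (h ▸ bot_mem)
  · exact hb (h ▸ top_mem)
  · have : c ≤ b := h ▸ le_sup_right
    rw [inf_eq_right.2 this] at hbc
    exact hc (hbc ▸ bot_mem)
  · have : b ≤ bᶜ := calc
      b = (b ⊔ c)ᶜ := h
      _ ≤ bᶜ := compl_le_compl le_sup_left
    have : b = ⊥ := le_bot_iff.1 ((le_inf le_rfl this).trans_eq inf_compl_eq_bot)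
    exact hb (this ▸ bot_mem)

theorem mem_sup_closure_singleton {p b : B} {S : BooleanSubalgebra B} :
    b ∈ closure {p} ⊔ S ↔ ∃ x ∈ S, ∃ y ∈ S, b = (p ⊓ x) ⊔ (pᶜ ⊓ y) := by
  constructor
  · intro hb
    -- `T` consists of the elements that agree with some member of `S` on `p` and with some member
    -- of `S` on `pᶜ`.
    let T : BooleanSubalgebra B :=
      { carrier := {b | ∃ x ∈ S, ∃ y ∈ S, p ⊓ b = p ⊓ x ∧ pᶜ ⊓ b = pᶜ ⊓ y}
        supClosed' := by
          rintro _ ⟨x, hx, y, hy, h₁, h₂⟩ _ ⟨x', hx', y', hy', h₁', h₂'⟩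
          exact ⟨x ⊔ x', sup_mem hx hx', y ⊔ y', sup_mem hy hy',
            by rw [inf_sup_left, h₁, h₁', inf_sup_left],
            by rw [inf_sup_left, h₂, h₂', inf_sup_left]⟩
        infClosed' := by
          rintro _ ⟨x, hx, y, hy, h₁, h₂⟩ _ ⟨x', hx', y', hy', h₁', h₂'⟩
          exact ⟨x ⊓ x', inf_mem hx hx', y ⊓ y', inf_mem hy hy',
            by rw [inf_inf_distrib_left, h₁, h₁', ← inf_inf_distrib_left],
            by rw [inf_inf_distrib_left, h₂, h₂', ← inf_inf_distrib_left]⟩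
        compl_mem' := by
          rintro a ⟨x, hx, y, hy, h₁, h₂⟩
          have aux : ∀ {q a x : B}, q ⊓ a = q ⊓ x → q ⊓ aᶜ = q ⊓ xᶜ := by
            intro q a x h
            have := congrArg (fun t => q ⊓ tᶜ) h
            simpa [compl_inf, inf_sup_left] using this
          exact ⟨xᶜ, compl_mem hx, yᶜ, compl_mem hy, aux h₁, aux h₂⟩
        bot_mem' := ⟨⊥, bot_mem, ⊥, bot_mem, rfl, rfl⟩ }
    have hT : closure {p} ⊔ S ≤ T := sup_le
      (closure_le_of_mem ⟨⊤, top_mem, ⊥, bot_mem, by simp, by simp⟩)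
      fun x hx => ⟨x, hx, x, hx, rfl, rfl⟩
    obtain ⟨x, hx, y, hy, h₁, h₂⟩ := hT hb
    exact ⟨x, hx, y, hy, by rw [← h₁, ← h₂, ← inf_sup_right, sup_compl_eq_top, top_inf_eq]⟩
  · rintro ⟨x, hx, y, hy, rfl⟩
    have hp : p ∈ closure {p} ⊔ S := (le_sup_left : closure {p} ≤ _) (mem_closure_self p)
    have hS : S ≤ closure {p} ⊔ S := le_sup_right
    exact sup_mem (inf_mem hp (hS hx)) (inf_mem (compl_mem hp) (hS hy))

/-- Modulo the subalgebra generated by an atom `p`, joining with `p` changes elements by `p`. -/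
theorem exists_of_mem_sup_closure {p b : B} {S : BooleanSubalgebra B} (hp : ∀ x ≤ p, x = ⊥ ∨ x = p)
    (hb : b ∈ closure {p} ⊔ S) : ∃ y ∈ S, b = p ⊔ y ∨ b = pᶜ ⊓ y := by
  obtain ⟨x, hx, y, hy, rfl⟩ := mem_sup_closure_singleton.1 hb
  refine ⟨y, hy, ?_⟩
  rcases hp (p ⊓ x) inf_le_left with h | h <;> rw [h]
  · right; rw [bot_sup_eq]
  · left; rw [sup_inf_left, sup_compl_eq_top, top_inf_eq]

/-- Joining with an atom changes an element only on that atom, so the witness from the other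
subalgebra can be recovered inside the bound. This is what excludes overlapping pairs in clause
(iii), where the meet must not be dual modular. -/
theorem isDualModular_closure_singleton {p : B} (hp : ∀ x ≤ p, x = ⊥ ∨ x = p) :
    IsDualModular (closure {p}) := by
  refine ⟨fun Y Z j m t hXZ hj hm ht => ?_, fun W Y j m t hWY hj hm ht => ?_⟩
  · obtain rfl := hj.unique isLUB_pair
    obtain rfl := hm.unique isGLB_pair
    obtain rfl := ht.unique isGLB_pair
    suffices h : (closure {p} ⊔ Y) ⊓ Z = closure {p} ⊔ Y ⊓ Z from h ▸ isLUB_pair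
    refine le_antisymm ?_ (sup_le (le_inf le_sup_left hXZ) (inf_le_inf_right _ le_sup_right))
    have hpT : p ∈ closure {p} ⊔ Y ⊓ Z := (le_sup_left : closure {p} ≤ _) (mem_closure_self p)
    have hpZ : p ∈ Z := hXZ (mem_closure_self p)
    have low : ∀ b ∈ (closure {p} ⊔ Y) ⊓ Z, b ≤ pᶜ → b ∈ closure {p} ⊔ Y ⊓ Z := by
      rintro b ⟨hb, hbZ⟩ hbp
      obtain ⟨y, hy, h⟩ := exists_of_mem_sup_closure hp hb
      have hby : b = pᶜ ⊓ y := by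
        rcases h with h | h
        · rw [← inf_eq_right.2 hbp, h, inf_sup_left, compl_inf_eq_bot, bot_sup_eq]
        · exact h
      have hYZ : ∀ x ∈ Y, x ∈ Z → x ∈ closure {p} ⊔ Y ⊓ Z := fun x h₁ h₂ =>
        (le_sup_right : Y ⊓ Z ≤ _) ⟨h₁, h₂⟩
      have hyZ : y ∈ Z := by
        have : y = (p ⊓ y) ⊔ (pᶜ ⊓ y) := by
          rw [← inf_sup_right, sup_compl_eq_top, top_inf_eq]
        rw [this, ← hby]
        refine sup_mem ?_ hbZ
        rcases hp (p ⊓ y) inf_le_left with h | h <;> rw [h]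
        exacts [bot_mem, hpZ]
      rw [hby]
      exact inf_mem (compl_mem hpT) (hYZ y hy hyZ)
    intro b hb
    have h₁ : pᶜ ⊓ b ∈ closure {p} ⊔ Y ⊓ Z := by
      refine low _ ?_ inf_le_left
      refine inf_mem (compl_mem ?_) hb
      exact ⟨(le_sup_left : closure {p} ≤ _) (mem_closure_self p), hpZ⟩
    have h₂ : b = (p ⊓ b) ⊔ (pᶜ ⊓ b) := by
      rw [← inf_sup_right, sup_compl_eq_top, top_inf_eq]
    rw [h₂]
    refine sup_mem ?_ h₁
    rcases hp (p ⊓ b) inf_le_left with h | h <;> rw [h]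
    exacts [bot_mem, hpT]
  · obtain rfl := hj.unique isLUB_pair
    obtain rfl := hm.unique isGLB_pair
    obtain rfl := ht.unique isGLB_pair
    suffices h : (W ⊔ closure {p}) ⊓ Y = W ⊔ closure {p} ⊓ Y from h ▸ isLUB_pair
    refine le_antisymm ?_ (sup_le (le_inf le_sup_left hWY) (inf_le_inf_right _ le_sup_right))
    have key : ∀ b ∈ (W ⊔ closure {p}) ⊓ Y, ∀ w ∈ W, b = p ⊔ w → b ∈ W ⊔ closure {p} ⊓ Y := by
      rintro b ⟨hb, hbY⟩ w hw rfl
      have hpw : p ⊓ wᶜ ∈ Y := by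
        have : p ⊓ wᶜ = (p ⊔ w) ⊓ wᶜ := by rw [inf_sup_right, inf_compl_eq_bot, sup_bot_eq]
        rw [this]
        exact inf_mem hbY (compl_mem (hWY hw))
      have hW : W ≤ W ⊔ closure {p} ⊓ Y := le_sup_left
      rcases hp (p ⊓ wᶜ) inf_le_left with h | h
      · have : p ≤ w := by rwa [← disjoint_iff, disjoint_compl_right_iff] at h
        rw [sup_eq_right.2 this]
        exact hW hw
      · rw [h] at hpw
        exact sup_mem ((le_sup_right : closure {p} ⊓ Y ≤ _) ⟨mem_closure_self p, hpw⟩) (hW hw)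
    intro b hb
    have hb' := hb.1
    rw [sup_comm] at hb'
    obtain ⟨w, hw, h | h⟩ := exists_of_mem_sup_closure hp hb'
    · exact key b hb w hw h
    · rw [← compl_mem_iff]
      refine key bᶜ (compl_mem hb) wᶜ (compl_mem hw) ?_
      rw [h, compl_inf, compl_compl]

/-- A principal pair for the subalgebra generated by `p` consists of the principal subalgebras of
`p` and of its complement. -/
theorem eq_principal_of_isPrincipalPairFor {p : B} {Y Z : BooleanSubalgebra B}
    (h : IsPrincipalPairFor (closure {p}) (Y, Z)) :
    Y = principal p ∧ Z = principal pᶜ ∨ Y = principal pᶜ ∧ Z = principal p := by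
  -- If one component is `⊤`, the other is `closure {p}` itself. Being dual modular, it contains the
  -- ideal of `p` or of `pᶜ`, so that element is `⊥` or an atom, and the pair already has the
  -- required form.
  have top_case : IsDualModular (closure {p}) →
      closure {p} = principal p ∧ ⊤ = principal pᶜ ∨
        closure {p} = principal pᶜ ∧ ⊤ = principal p := by
    have aux : ∀ q : B, (∀ b ≤ q, b ∈ closure {q}) →
        closure {q} = principal q ∧ ⊤ = principal qᶜ := by
      intro q hq
      have h₁ : ∀ b ≤ q, b = ⊥ ∨ b = q := by
        intro b hb
        rcases mem_closure_singleton.1 (hq b hb) with h | h | h | h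
        · exact Or.inl h
        · exact Or.inr (le_antisymm hb (h ▸ le_top))
        · exact Or.inr h
        · left
          have : q = ⊤ := top_le_iff.1 (by
            rw [← sup_compl_eq_top (x := q)]; exact sup_le le_rfl (h ▸ hb))
          rw [h, this, compl_top]
      have h₂ : principal q ≤ closure {q} := by
        rintro b (hb | hb)
        · exact hq b hb
        · exact compl_mem_iff.1 (hq _ (compl_le_iff_compl_le.1 hb))
      have h₃ : (⊤ : BooleanSubalgebra B) ≤ principal qᶜ := by
        intro b _
        rw [mem_principal_compl]
        rcases h₁ (q ⊓ b) inf_le_left with h | h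
        · exact Or.inl (le_compl_iff_disjoint_left.2 (disjoint_iff.2 h))
        · exact Or.inr (inf_eq_left.1 h)
      exact ⟨le_antisymm (principal_inf_principal_compl q ▸ inf_le_left) h₂,
        le_antisymm h₃ le_top⟩
    intro hdm
    rcases le_mem_or_le_compl_mem hdm (mem_closure_self p) with h | h
    · exact Or.inl (aux p h)
    · right
      have := aux pᶜ (by rwa [closure_compl])
      rwa [closure_compl, compl_compl] at this
  obtain ⟨⟨hY, hZ, h⟩, hglb⟩ := h
  dsimp only at hY hZ h hglb
  have hYZ : Y ⊓ Z = closure {p} := isGLB_pair.unique hglb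
  rcases h with ⟨rfl, -⟩ | ⟨rfl, -⟩ | ⟨-, m, hm, -, hmn⟩
  · rw [top_inf_eq] at hYZ
    subst hYZ
    have := top_case hZ
    tauto
  · rw [inf_top_eq] at hYZ
    subst hYZ
    have := top_case hY
    tauto
  obtain rfl := hm.unique hglb
  have hYtop : Y ≠ ⊤ := by
    rintro rfl
    rw [top_inf_eq] at hYZ
    exact hmn (hYZ ▸ hZ)
  have hZtop : Z ≠ ⊤ := by
    rintro rfl
    rw [inf_top_eq] at hYZ
    exact hmn (hYZ ▸ hY)
  have hpYZ : p ∈ Y ⊓ Z := hYZ ▸ mem_closure_self p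
  have eq_top : ∀ {S : BooleanSubalgebra B} {q : B}, (∀ b ≤ q, b ∈ S) → (∀ b ≤ qᶜ, b ∈ S) →
      S = ⊤ := by
    intro S q h₁ h₂
    refine top_le_iff.1 fun b _ => ?_
    have : b = (q ⊓ b) ⊔ (qᶜ ⊓ b) := by rw [← inf_sup_right, sup_compl_eq_top, top_inf_eq]
    rw [this]
    exact sup_mem (h₁ _ inf_le_left) (h₂ _ inf_le_left)
  -- If both components contain the ideal of the same `q`, then `q` is `⊥` or an atom and the meet
  -- is dual modular.
  have atom_case : ∀ q : B, closure {q} = closure {p} → (∀ b ≤ q, b ∈ Y) → (∀ b ≤ q, b ∈ Z) →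
      False := by
    intro q hq h₁ h₂
    refine hmn (hq ▸ isDualModular_closure_singleton fun b hb => ?_)
    have hb' : b ∈ closure {q} := hq ▸ hYZ ▸ ⟨h₁ b hb, h₂ b hb⟩
    rcases mem_closure_singleton.1 hb' with h | h | h | h
    · exact Or.inl h
    · exact Or.inr (le_antisymm hb (h ▸ le_top))
    · exact Or.inr h
    · left
      have : q = ⊤ := top_le_iff.1 (by
        rw [← sup_compl_eq_top (x := q)]; exact sup_le le_rfl (h ▸ hb))
      rw [h, this, compl_top]
  -- If the ideal of `s` lies in `S`, then `s ⊓ qᶜ` lies in `S ⊓ T`, hence is `⊥` or `qᶜ`. The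
  -- second would put the ideals of both `q` and `qᶜ` into `S` and make it `⊤`.
  have main : ∀ (q : B) (S T : BooleanSubalgebra B), S ⊓ T = closure {q} → IsDualModular S →
      S ≠ ⊤ → (∀ b ≤ q, b ∈ S) → (∀ b ≤ qᶜ, b ∈ T) → S = principal q := by
    intro q S T hST hS hStop h₁ h₂
    refine le_antisymm ?_ ?_
    · have low : ∀ s ∈ S, (∀ b ≤ s, b ∈ S) → s ≤ q := by
        intro s hs hsS
        have hmem : s ⊓ qᶜ ∈ closure {q} := hST ▸ ⟨hsS _ inf_le_left, h₂ _ inf_le_right⟩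
        have hbot : s ⊓ qᶜ = ⊥ ∨ s ⊓ qᶜ = qᶜ := by
          rcases mem_closure_singleton.1 hmem with h | h | h | h
          · exact Or.inl h
          · exact Or.inr (le_antisymm inf_le_right (h ▸ le_top))
          · left
            have hq : q ≤ qᶜ := calc
              q = s ⊓ qᶜ := h.symm
              _ ≤ qᶜ := inf_le_right
            rw [h]
            exact le_bot_iff.1 ((le_inf le_rfl hq).trans_eq inf_compl_eq_bot)
          · exact Or.inr h
        rcases hbot with h | h
        · rwa [← disjoint_iff, disjoint_compl_right_iff] at h
        · exact absurd (eq_top h₁ fun b hb => hsS b (hb.trans (inf_eq_right.1 h))) hStop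
      intro s hs
      rcases le_mem_or_le_compl_mem hS hs with h | h
      · exact Or.inl (low s hs h)
      · exact Or.inr (compl_le_iff_compl_le.1 (low sᶜ (compl_mem hs) h))
    · rintro b (hb | hb)
      · exact h₁ b hb
      · exact compl_mem_iff.1 (h₁ _ (compl_le_iff_compl_le.1 hb))
  have hZY : Z ⊓ Y = closure {p} := inf_comm Y Z ▸ hYZ
  rcases le_mem_or_le_compl_mem hY hpYZ.1 with h₁ | h₁ <;>
  rcases le_mem_or_le_compl_mem hZ hpYZ.2 with h₂ | h₂
  · exact (atom_case p rfl h₁ h₂).elim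
  · exact Or.inl ⟨main p Y Z hYZ hY hYtop h₁ h₂, main pᶜ Z Y (closure_compl p ▸ hZY) hZ hZtop h₂
      (by rwa [compl_compl])⟩
  · exact Or.inr ⟨main pᶜ Y Z (closure_compl p ▸ hYZ) hY hYtop h₁ (by rwa [compl_compl]),
      main p Z Y hZY hZ hZtop h₂ h₁⟩
  · exact (atom_case pᶜ (closure_compl p) h₁ h₂).elim

theorem closure_eq_top_of_principal_eq {p : B} (h : principal p = principal pᶜ) :
    closure {p} = ⊤ := by
  have h₁ : principal p = closure {p} := by
    rw [← principal_inf_principal_compl, ← h, inf_idem]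
  have h₂ : principal pᶜ = closure {p} := h ▸ h₁
  refine top_le_iff.1 fun b _ => ?_
  have : b = (p ⊓ b) ⊔ (pᶜ ⊓ b) := by rw [← inf_sup_right, sup_compl_eq_top, top_inf_eq]
  rw [this]
  refine sup_mem ?_ ?_
  · rw [← h₁]; exact Or.inl inf_le_left
  · rw [← h₂]; exact Or.inl inf_le_left

/-- The intersections of the pairs give `p` up to complement (and `⊥` up to `⊤`). Orientation is
lost only when `principal p = principal pᶜ`, which would make the whole algebra basic. -/
theorem eq_of_principal_eq {p q : B} (hB : ¬ IsBasic (⊤ : BooleanSubalgebra B))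
    (h : principal p = principal q) (h' : principal pᶜ = principal qᶜ) : p = q := by
  have hcl : closure {p} = closure {q} := by
    rw [← principal_inf_principal_compl, h, h', principal_inf_principal_compl]
  have hne : ∀ r : B, principal r ≠ principal rᶜ := fun r hr =>
    hB (isBasic_iff.2 ⟨r, (closure_eq_top_of_principal_eq hr).symm⟩)
  have hp : p ∈ closure {q} := hcl ▸ mem_closure_self p
  have hq : q ∈ closure {p} := hcl ▸ mem_closure_self q
  have htop : principal (⊤ : B) = ⊤ := principal_top
  have hbt : principal (⊥ : B) ≠ principal ⊤ := by simpa using hne ⊥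
  rcases mem_closure_singleton.1 hp with hp | hp | hp | hp
  · rcases mem_closure_singleton.1 hq with hq | hq | hq | hq
    · rw [hp, hq]
    · rw [hp, hq] at h; exact absurd h hbt
    · exact hq.symm
    · rw [hp, compl_bot] at hq; rw [hp, hq] at h; exact absurd h hbt
  · rcases mem_closure_singleton.1 hq with hq | hq | hq | hq
    · rw [hp, hq] at h; exact absurd h.symm hbt
    · rw [hp, hq]
    · exact hq.symm
    · rw [hp, compl_top] at hq; rw [hp, hq] at h; exact absurd h.symm hbt
  · exact hp
  · rw [hp] at h; exact absurd h.symm (hne q)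

end BooleanSubalgebra

end BooleanSubalgebras

/-! ### Covers in the lattice of subalgebras. -/

section BooleanSubalgebraCovers

variable {B : Type u} [BooleanAlgebra B]

namespace BooleanSubalgebra

theorem inf_principal_eq {p : B} {W : BooleanSubalgebra B} (hp : p ∈ W) (hW : W ≤ principal pᶜ) :
    W ⊓ principal p = closure {p} := by
  refine le_antisymm ?_ (le_inf (closure_le_of_mem hp) ?_)
  · rw [← principal_inf_principal_compl]
    exact le_inf inf_le_right (inf_le_left.trans hW)
  · exact (closure_le_principal_inf p).trans inf_le_left

theorem sup_le_principal_compl {p q : B} (h : Disjoint p q) :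
    closure {p} ⊔ closure {q} ≤ principal pᶜ :=
  sup_le (closure_le_of_mem (mem_principal_compl.2 (Or.inr le_rfl)))
    (closure_le_of_mem (Or.inl h.le_compl_left))

theorem sup_le_principal_sup (p q : B) :
    closure {p} ⊔ closure {q} ≤ principal (p ⊔ q) :=
  sup_le (closure_le_of_mem (Or.inl le_sup_left)) (closure_le_of_mem (Or.inl le_sup_right))

theorem mem_sup_left (p q : B) : p ∈ closure {p} ⊔ closure {q} :=
  (le_sup_left : closure {p} ≤ _) (mem_closure_self p)

theorem mem_sup_right (p q : B) : q ∈ closure {p} ⊔ closure {q} :=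
  (le_sup_right : closure {q} ≤ closure {p} ⊔ closure {q}) (mem_closure_self q)

theorem closure_ne_bot {p q : B} (hp : p ≠ ⊥) (hpq : p ⊔ q ≠ ⊤) : closure {p} ≠ ⊥ := by
  rw [Ne, closure_singleton_eq_bot]
  rintro (h | rfl)
  · exact hp h
  · exact hpq (top_sup_eq _)

theorem closure_ne_closure {p q : B} (hp : p ≠ ⊥) (hq : q ≠ ⊥) (h : Disjoint p q)
    (hpq : p ⊔ q ≠ ⊤) : closure {p} ≠ closure {q} := by
  intro heq
  have hmem : p ∈ closure {q} := heq ▸ mem_closure_self p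
  rcases mem_closure_singleton.1 hmem with h' | h' | h' | h'
  · exact hp h'
  · exact hpq (by rw [h', top_sup_eq])
  · rw [h', disjoint_self] at h
    exact hq h
  · exact hpq (by rw [h', compl_sup_eq_top])

/-- The join is the eight-element algebra with atoms `p`, `q` and `(p ⊔ q)ᶜ`. Any member outside
`closure {p}` has as its part below `pᶜ` one of the other two atoms, and either of these together
with `p` generates `q`. -/
theorem closure_covBy_sup {p q : B} (hp : p ≠ ⊥) (hq : q ≠ ⊥) (h : Disjoint p q)
    (hpq : p ⊔ q ≠ ⊤) : closure {p} ⋖ closure {p} ⊔ closure {q} := by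
  refine ⟨lt_of_le_of_ne le_sup_left fun heq => ?_, fun V hpV hVW => ?_⟩
  · refine closure_ne_closure hq hp h.symm (sup_comm p q ▸ hpq) (closure_singleton_eq ?_ ?_)
    · exact closure_ne_bot hq (sup_comm p q ▸ hpq)
    · exact heq.symm ▸ mem_sup_right p q
  refine hVW.not_ge (sup_le hpV.le (closure_le_of_mem ?_))
  obtain ⟨v, hv, hvp⟩ := SetLike.exists_of_lt hpV
  have hpmem : p ∈ V := hpV.le (mem_closure_self p)
  have main : ∀ v ∈ V, v ≤ pᶜ → v ≠ ⊥ → v ≠ pᶜ → q ∈ V := by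
    intro v hv hvp hv₀ hv₁
    have hsup : v ≤ p ⊔ q → v ≤ q := fun h => calc
      v ≤ pᶜ ⊓ (p ⊔ q) := le_inf hvp h
      _ = pᶜ ⊓ q := by rw [inf_sup_left, compl_inf_eq_bot, bot_sup_eq]
      _ ≤ q := inf_le_right
    have hr : (p ⊔ q)ᶜ ≤ v → q ≤ v → v = pᶜ := fun h₁ h₂ => le_antisymm hvp <| by
      calc pᶜ = pᶜ ⊓ (q ⊔ qᶜ) := by rw [sup_compl_eq_top, inf_top_eq]
        _ = (pᶜ ⊓ q) ⊔ (p ⊔ q)ᶜ := by rw [inf_sup_left, compl_sup]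
        _ ≤ v := sup_le (inf_le_right.trans h₂) h₁
    have h₁ := mem_principal_compl.1
      ((sup_comm (closure {p}) (closure {q}) ▸ sup_le_principal_compl h.symm) (hVW.le hv))
    rcases h₁ with h₁ | h₁ <;> rcases sup_le_principal_sup p q (hVW.le hv) with h₂ | h₂
    · exact absurd (le_bot_iff.1 ((le_inf (hsup h₂) h₁).trans_eq inf_compl_eq_bot)) hv₀
    · have : v = (p ⊔ q)ᶜ := le_antisymm (by rw [compl_sup]; exact le_inf hvp h₁) h₂
      have hmem : pᶜ ⊓ vᶜ ∈ V := inf_mem (compl_mem hpmem) (compl_mem hv)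
      rwa [this, compl_compl, inf_sup_left, compl_inf_eq_bot, bot_sup_eq,
        inf_eq_right.2 h.le_compl_left] at hmem
    · exact le_antisymm h₁ (hsup h₂) ▸ hv
    · exact absurd (hr h₂ h₁) hv₁
  have hdec : v = (p ⊓ v) ⊔ (pᶜ ⊓ v) := by rw [← inf_sup_right, sup_compl_eq_top, top_inf_eq]
  have hpv : p ⊓ v = ⊥ ∨ p ⊓ v = p := by
    rcases sup_le_principal_compl h (hVW.le hv) with h' | h'
    · exact Or.inl (disjoint_iff.1 (le_compl_iff_disjoint_left.1 h'))
    · exact Or.inr (inf_eq_left.2 (by simpa using h'))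
  refine main (pᶜ ⊓ v) (inf_mem (compl_mem hpmem) hv) inf_le_left (fun h' => hvp ?_)
    fun h' => hvp ?_
  all_goals
    rw [hdec, h']
    refine sup_mem ?_ ?_
    · rcases hpv with h | h <;> rw [h]
      exacts [bot_mem, mem_closure_self p]
    · first | exact bot_mem | exact compl_mem (mem_closure_self p)

theorem closure_sup_covBy_sup {p q : B} (hp : p ≠ ⊥) (hq : q ≠ ⊥) (h : Disjoint p q)
    (hpq : p ⊔ q ≠ ⊤) : closure {p ⊔ q} ⋖ closure {p} ⊔ closure {q} := by
  -- The three atoms of the eight-element algebra play symmetric roles, so the previous cover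
  -- applies to `(p ⊔ q)ᶜ` and `p`.
  have hsup : closure {(p ⊔ q)ᶜ} ⊔ closure {p} = closure {p} ⊔ closure {q} := by
    rw [closure_compl]
    refine le_antisymm (sup_le (closure_le_of_mem (sup_mem (mem_sup_left p q)
      (mem_sup_right p q))) le_sup_left) (sup_le le_sup_right (closure_le_of_mem ?_))
    have : q = (p ⊔ q) ⊓ pᶜ := by
      rw [inf_sup_right, inf_compl_eq_bot, bot_sup_eq, inf_eq_left.2 h.le_compl_left]
    have hmem := inf_mem (mem_sup_left (p ⊔ q) p) (compl_mem (mem_sup_right (p ⊔ q) p))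
    rwa [← this] at hmem
  rw [← closure_compl, ← hsup]
  refine closure_covBy_sup (fun h' => hpq (compl_eq_bot.1 h')) hp ?_ ?_
  · exact (disjoint_compl_left_iff.2 le_sup_left)
  · intro h'
    have : q = ⊥ := calc
      q = q ⊓ ((p ⊔ q)ᶜ ⊔ p) := by rw [h', inf_top_eq]
      _ = ⊥ := by
        rw [inf_sup_left, compl_sup, inf_left_comm, inf_compl_eq_bot, inf_bot_eq, bot_sup_eq,
          inf_comm, h.eq_bot]
    exact hq this

theorem exists_covBy_of_isBasic {S : BooleanSubalgebra B} (hS : IsBasic S) (htop : S ≠ ⊤) :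
    ∃ V, S ⋖ V := by
  obtain ⟨p, rfl⟩ := isBasic_iff.1 hS
  -- A new element `c` below `q` splits `q`: adjoining it to `{qᶜ}` gives an eight-element algebra,
  -- or an atom when `q = ⊤`.
  have main : ∀ q c : B, closure {q} = closure {p} → c ≤ q → c ∉ closure {p} →
      ∃ V, closure {p} ⋖ V := by
    intro q c hq hc hcp
    by_cases hq₁ : q = ⊤
    · refine ⟨closure {c}, ?_⟩
      have hbot : closure {p} = ⊥ := hq ▸ closure_singleton_eq_bot.2 (Or.inr hq₁)
      rw [hbot, bot_covBy_iff]
      rw [hbot, mem_bot, ← closure_singleton_eq_bot] at hcp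
      exact (isBasic_iff.2 ⟨c, rfl⟩).resolve_left hcp
    · rw [← hq, ← closure_compl]
      refine ⟨_, closure_covBy_sup (fun h => hq₁ (compl_eq_bot.1 h)) (fun h => hcp ?_)
        (disjoint_compl_left_iff.2 hc) (fun h => hcp ?_)⟩
      · exact h ▸ bot_mem
      · have : q ≤ c := by
          calc q = q ⊓ (qᶜ ⊔ c) := by rw [h, inf_top_eq]
            _ = q ⊓ c := by rw [inf_sup_left, inf_compl_eq_bot, bot_sup_eq]
            _ ≤ c := inf_le_right
        rw [← hq, le_antisymm hc this]
        exact mem_closure_self q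
  obtain ⟨b, -, hb⟩ := SetLike.exists_of_lt (lt_top_iff_ne_top.2 htop)
  by_cases h : p ⊓ b ∈ closure {p}
  · refine main pᶜ (pᶜ ⊓ b) (closure_compl p) inf_le_left fun h' => hb ?_
    rw [← top_inf_eq b, ← sup_compl_eq_top (x := p), inf_sup_right]
    exact sup_mem h h'
  · exact main p (p ⊓ b) rfl inf_le_left h

end BooleanSubalgebra

end BooleanSubalgebraCovers

/-! ### Transport along order isomorphisms and to principal ideals. -/

section OrderIsoTransport

variable {L M : Type u} [PartialOrder L] [PartialOrder M] (φ : L ≃o M)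

theorem OrderIso.isLUB_pair_iff {a b c : L} :
    IsLUB {φ a, φ b} (φ c) ↔ IsLUB {a, b} c := by
  rw [← Set.image_pair, φ.isLUB_image']

theorem OrderIso.isGLB_pair_iff {a b c : L} :
    IsGLB {φ a, φ b} (φ c) ↔ IsGLB {a, b} c := by
  rw [← Set.image_pair, φ.isGLB_image']

theorem IsDualModular.map {x : L} (hx : IsDualModular x) : IsDualModular (φ x) := by
  refine ⟨fun y z j m t => ?_, fun w y j m t => ?_⟩
  · obtain ⟨y, rfl⟩ := φ.surjective y
    obtain ⟨z, rfl⟩ := φ.surjective z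
    obtain ⟨j, rfl⟩ := φ.surjective j
    obtain ⟨m, rfl⟩ := φ.surjective m
    obtain ⟨t, rfl⟩ := φ.surjective t
    simp only [φ.isLUB_pair_iff, φ.isGLB_pair_iff, φ.le_iff_le]
    exact hx.1 y z j m t
  · obtain ⟨w, rfl⟩ := φ.surjective w
    obtain ⟨y, rfl⟩ := φ.surjective y
    obtain ⟨j, rfl⟩ := φ.surjective j
    obtain ⟨m, rfl⟩ := φ.surjective m
    obtain ⟨t, rfl⟩ := φ.surjective t
    simp only [φ.isLUB_pair_iff, φ.isGLB_pair_iff, φ.le_iff_le]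
    exact hx.2 w y j m t

theorem isDualModular_map_iff {x : L} : IsDualModular (φ x) ↔ IsDualModular x :=
  ⟨fun h => by simpa using h.map φ.symm, fun h => h.map φ⟩

theorem isBasic_map_iff [OrderBot L] [OrderBot M] {x : L} : IsBasic (φ x) ↔ IsBasic x := by
  rw [IsBasic, IsBasic, map_eq_bot_iff, φ.isAtom_iff]

theorem IsPrincipalPairFor.map [OrderBot L] [OrderTop L] [OrderBot M] [OrderTop M] {x a b : L}
    (h : IsPrincipalPairFor x (a, b)) : IsPrincipalPairFor (φ x) (φ a, φ b) := by
  obtain ⟨⟨ha, hb, h⟩, hx⟩ := h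
  refine ⟨⟨ha.map φ, hb.map φ, ?_⟩, φ.isGLB_pair_iff.2 hx⟩
  dsimp only at h ⊢
  rcases h with ⟨h, h'⟩ | ⟨h, h'⟩ | ⟨h, m, hm, hm', hm''⟩
  · exact Or.inl ⟨h ▸ φ.map_top, (isBasic_map_iff φ).2 h'⟩
  · exact Or.inr (Or.inl ⟨h ▸ φ.map_top, (isBasic_map_iff φ).2 h'⟩)
  · refine Or.inr (Or.inr ⟨?_, φ m, φ.isGLB_pair_iff.2 hm, (isBasic_map_iff φ).2 hm',
      fun h => hm'' ((isDualModular_map_iff φ).1 h)⟩)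
    rw [← φ.map_top]
    exact φ.isLUB_pair_iff.2 h

end OrderIsoTransport

section IicTransport

theorem covBy_coe_Iic {X : Type u} [PartialOrder X] {t : X} {x y : Set.Iic t} :
    (x : X) ⋖ y ↔ x ⋖ y :=
  ⟨fun h => ⟨h.1, fun _ h₁ h₂ => h.2 h₁ h₂⟩,
    fun h => ⟨h.1, fun c h₁ h₂ => h.2 (c := ⟨c, h₂.le.trans y.2⟩) h₁ h₂⟩⟩

theorem isGLB_coe_Iic {X : Type u} [PartialOrder X] {t : X} {x y z : Set.Iic t} :
    IsGLB {(x : X), (y : X)} (z : X) ↔ IsGLB {x, y} z := by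
  constructor
  · intro h
    exact ⟨by simpa [lowerBounds] using h.1, fun a ha => h.2 (by simpa [lowerBounds] using ha)⟩
  · intro h
    refine ⟨by simpa [lowerBounds] using h.1, fun a ha => ?_⟩
    have hax : a ≤ x := ha (by simp)
    have hay : a ≤ y := ha (by simp)
    exact h.2 (show (⟨a, hax.trans x.2⟩ : Set.Iic t) ∈ lowerBounds {x, y} by
      simpa [lowerBounds] using ⟨hax, hay⟩)

variable {X : Type u} [PartialOrder X] [OrderBot X]

theorem isAtom_coe_Iic {t : X} {x : Set.Iic t} : IsAtom (x : X) ↔ IsAtom x := by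
  rw [← bot_covBy_iff, ← bot_covBy_iff, ← covBy_coe_Iic]
  rfl

theorem isBasic_coe_Iic {t : X} {x : Set.Iic t} : IsBasic (x : X) ↔ IsBasic x := by
  rw [IsBasic, IsBasic, isAtom_coe_Iic, ← Subtype.coe_inj]
  rfl

theorem IsOrthodomain.exists_covBy_le (hX : IsOrthodomain X) {x z : X} (hx : IsBasic x)
    (hxz : x < z) : ∃ y, x ⋖ y ∧ y ≤ z := by
  obtain ⟨B, _, ⟨φ⟩⟩ := hX.booleanDomain_Iic z
  let x' : Set.Iic z := ⟨x, hxz.le⟩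
  have hx' : IsBasic (φ x') := (isBasic_map_iff φ).2 ((isBasic_coe_Iic (x := x')).1 hx)
  have hne : φ x' ≠ ⊤ := by
    rw [Ne, map_eq_top_iff]
    exact fun h => hxz.ne (congrArg Subtype.val h)
  obtain ⟨V, hV⟩ := BooleanSubalgebra.exists_covBy_of_isBasic hx' hne
  refine ⟨φ.symm V, ?_, (φ.symm V).2⟩
  exact (covBy_coe_Iic (x := x')).2 ((apply_covBy_apply_iff φ).1 (by rwa [φ.apply_symm_apply]))

end IicTransport

/-! ### Rigidity: one value above the base determines a direction. -/

namespace Direction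

variable {X : Type u} [PartialOrder X] [OrderBot X] {d e : Direction X}

theorem exists_value (d : Direction X) {y : X} (h : d.base ≤ y) : ∃ p, d.Value y p := ⟨_, h, rfl⟩

theorem Value.unique {y : X} {p q : X × X} (h : d.Value y p) (h' : d.Value y q) : p = q := by
  obtain ⟨_, rfl⟩ := h
  obtain ⟨_, rfl⟩ := h'
  rfl

theorem Value.base_le {y : X} {p : X × X} (h : d.Value y p) : d.base ≤ y := h.1

theorem Value.principal {y : X} {p : X × X} (h : d.Value y p) :
    ∃ (h₀ : d.base ≤ y) (h₁ : p.1 ≤ y) (h₂ : p.2 ≤ y),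
      IsPrincipalPairFor (L := Set.Iic y) ⟨d.base, h₀⟩ (⟨p.1, h₁⟩, ⟨p.2, h₂⟩) := by
  obtain ⟨h₀, rfl⟩ := h
  exact ⟨h₀, d.principal ⟨y, h₀⟩⟩

theorem Value.compl {y : X} {p : X × X} (h : d.Value y p) : d.compl.Value y p.swap := by
  obtain ⟨h₀, rfl⟩ := h
  exact ⟨h₀, rfl⟩

@[simp] theorem compl_compl (d : Direction X) : d.compl.compl = d := rfl

theorem Value.restrict {y z : X} {p q : X × X} (hz : d.Value z q) (hy : d.Value y p)
    (hyz : y ≤ z) : IsGLB {y, q.1} p.1 ∧ IsGLB {y, q.2} p.2 := by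
  obtain ⟨hz, rfl⟩ := hz
  obtain ⟨hy, rfl⟩ := hy
  exact d.restrict ⟨y, hy⟩ ⟨z, hz⟩ hyz

theorem Value.isGLB {y : X} {p : X × X} (h : d.Value y p) : IsGLB {p.1, p.2} d.base := by
  obtain ⟨h₀, h₁, h₂, h⟩ := h.principal
  exact isGLB_coe_Iic.2 h.2

theorem ext_value (hb : d.base = e.base) (h : ∀ y p, d.Value y p → e.Value y p) : d = e := by
  cases d with
  | mk b hb₀ f h₁ h₂ h₃ =>
    obtain rfl : b = e.base := hb
    refine Direction.ext rfl (heq_of_eq (funext fun y => ?_))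
    obtain ⟨_, h'⟩ := h y _ ⟨y.2, rfl⟩
    exact h'.symm

theorem value_of_le {y z : X} {p q : X × X} (hb : d.base = e.base) (hd : d.Value z p)
    (he : e.Value z p) (hyz : y ≤ z) (hy : d.Value y q) : e.Value y q := by
  obtain ⟨q', hq'⟩ := e.exists_value (hb ▸ hy.base_le : e.base ≤ y)
  have h₁ := hd.restrict hy hyz
  have h₂ := he.restrict hq' hyz
  rwa [Prod.ext (h₁.1.unique h₂.1) (h₁.2.unique h₂.2)]

theorem eq_or_eq_swap (hX : IsOrthodomain X) {y : X} {p q : X × X} (hb : d.base = e.base)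
    (hd : d.Value y p) (he : e.Value y q) : p = q ∨ p = q.swap := by
  obtain ⟨B, _, ⟨φ⟩⟩ := hX.booleanDomain_Iic y
  obtain ⟨h₀, h₁, h₂, h⟩ := hd.principal
  obtain ⟨_, h₁', h₂', h'⟩ := he.principal
  simp only [← hb] at h'
  have hbas : IsBasic (φ ⟨d.base, h₀⟩) :=
    (isBasic_map_iff φ).2 ((isBasic_coe_Iic (x := ⟨d.base, h₀⟩)).1 d.isBasic_base)
  obtain ⟨b, hb'⟩ := BooleanSubalgebra.isBasic_iff.1 hbas
  replace h := h.map φ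
  replace h' := h'.map φ
  rw [hb'] at h h'
  have cancel : ∀ {a c : X} (ha : a ≤ y) (hc : c ≤ y),
      φ ⟨a, ha⟩ = φ ⟨c, hc⟩ → a = c := fun ha hc h =>
    congrArg Subtype.val (φ.injective h)
  rcases BooleanSubalgebra.eq_principal_of_isPrincipalPairFor h with ⟨h₃, h₄⟩ | ⟨h₃, h₄⟩ <;>
  rcases BooleanSubalgebra.eq_principal_of_isPrincipalPairFor h' with ⟨h₅, h₆⟩ | ⟨h₅, h₆⟩
  · exact Or.inl (Prod.ext (cancel _ _ (h₃.trans h₅.symm)) (cancel _ _ (h₄.trans h₆.symm)))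
  · exact Or.inr (Prod.ext (cancel _ _ (h₃.trans h₆.symm)) (cancel _ _ (h₄.trans h₅.symm)))
  · exact Or.inr (Prod.ext (cancel _ _ (h₃.trans h₆.symm)) (cancel _ _ (h₄.trans h₅.symm)))
  · exact Or.inl (Prod.ext (cancel _ _ (h₃.trans h₅.symm)) (cancel _ _ (h₄.trans h₆.symm)))

theorem Value.eq_of_covBy {y : X} {p : X × X} (h : d.Value y p) (hy : d.base ⋖ y) :
    p = (d.base, y) ∨ p = (y, d.base) := by
  obtain ⟨h₀, h₁, h₂, ⟨-, -, hp⟩, hglb⟩ := h.principal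
  have hg := h.isGLB
  have hle₁ : d.base ≤ p.1 := hg.1 (by simp)
  have hle₂ : d.base ≤ p.2 := hg.1 (by simp)
  rcases hy.eq_or_eq hle₁ h₁ with e₁ | e₁ <;> rcases hy.eq_or_eq hle₂ h₂ with e₂ | e₂
  · exfalso
    rcases hp with ⟨h, -⟩ | ⟨h, -⟩ | ⟨h, -⟩
    · exact hy.ne (e₁.symm.trans (congrArg Subtype.val h))
    · exact hy.ne (e₂.symm.trans (congrArg Subtype.val h))
    · have : (⊤ : Set.Iic y) ≤ ⟨d.base, h₀⟩ := h.2 (by simp [upperBounds, e₁, e₂])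
      exact hy.lt.not_ge this
  · exact Or.inl (Prod.ext e₁ e₂)
  · exact Or.inr (Prod.ext e₁ e₂)
  · exfalso
    refine hy.lt.not_ge (hg.2 ?_)
    simp [lowerBounds, e₁, e₂]

/-- Opposite orientations of `d` let condition (3) produce `j` above `y` and `z`. At `j`, `e` agrees
with `d` or with `d'`; its value at `y` rules out `d'`, and restriction to `z` finishes. -/
theorem value_of_opposite (hX : IsOrthodomain X) {y z : X} (hb : d.base = e.base)
    (hy : d.base ⋖ y) (hz : d.base ⋖ z) (hdy : d.Value y (d.base, y)) (hdz : d.Value z (z, d.base))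
    (hey : e.Value y (d.base, y)) : e.Value z (z, d.base) := by
  obtain ⟨j, hj, hyj, hzj⟩ := d.exists_join ⟨y, hy.le⟩ ⟨z, hz.le⟩ hy hz hdy.2 hdz.2
  obtain ⟨p, hp⟩ := d.exists_value (hy.le.trans hyj.le)
  obtain ⟨q, hq⟩ := e.exists_value (hb ▸ hy.le.trans hyj.le : e.base ≤ j)
  rcases eq_or_eq_swap hX hb hp hq with rfl | rfl
  · exact value_of_le hb hp hq hzj.le hdz
  · have := (value_of_le (d := e) (e := d.compl) hb.symm hq hp.compl hyj.le hey).compl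
    exact absurd (congrArg Prod.fst (this.unique hdy)) hy.ne'

theorem value_of_covBy_aux (hX : IsOrthodomain X) {y z : X} {q : X × X} (hb : d.base = e.base)
    (hy : d.base ⋖ y) (hz : d.base ⋖ z) (hdy : d.Value y (d.base, y))
    (hey : e.Value y (d.base, y)) (hdz : d.Value z q) : e.Value z q := by
  rcases hdz.eq_of_covBy hz with rfl | rfl
  · obtain ⟨q', hq'⟩ := e.exists_value (hb ▸ hz.le : e.base ≤ z)
    rcases hq'.eq_of_covBy (hb ▸ hz) with rfl | rfl
    · rwa [hb]
    -- Here `d` has equal orientations, so condition (3) says nothing about it; if `e` disagreed at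
    -- `z`, it would be the one with opposite orientations.
    · have := value_of_opposite (d := e) (e := d) hX hb.symm (hb ▸ hy) (hb ▸ hz) (hb ▸ hey) hq'
        (hb ▸ hdy)
      exact absurd (congrArg Prod.fst (this.unique hdz)) hz.ne'
  · exact value_of_opposite hX hb hy hz hdy hdz hey

theorem value_of_covBy (hX : IsOrthodomain X) {y z : X} {p q : X × X} (hb : d.base = e.base)
    (hy : d.base ⋖ y) (hz : d.base ⋖ z) (hdy : d.Value y p) (hey : e.Value y p)
    (hdz : d.Value z q) : e.Value z q := by
  rcases hdy.eq_of_covBy hy with rfl | rfl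
  · exact value_of_covBy_aux hX hb hy hz hdy hey hdz
  · exact (value_of_covBy_aux (d := d.compl) (e := e.compl) hX hb hy hz hdy.compl hey.compl
      hdz.compl).compl

/-- A direction is determined by its base and by its value at one element above the base. -/
theorem eq_of_value (hX : IsOrthodomain X) {t : X} {p : X × X} (hb : d.base = e.base)
    (ht : d.base < t) (hd : d.Value t p) (he : e.Value t p) : d = e := by
  obtain ⟨y, hy, hyt⟩ := hX.exists_covBy_le d.isBasic_base ht
  obtain ⟨q, hq⟩ := d.exists_value hy.le
  have hq' := value_of_le hb hd he hyt hq
  refine ext_value hb fun z r hr => ?_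
  obtain ⟨s, hs⟩ := e.exists_value (hb ▸ hr.base_le : e.base ≤ z)
  rcases eq_or_eq_swap hX hb hr hs with rfl | rfl
  · exact hs
  rcases hr.base_le.eq_or_lt with hz | hz
  · have eq_base : ∀ {f : Direction X} {s : X × X}, f.Value f.base s → s = (f.base, f.base) := by
      intro f s hs
      obtain ⟨-, h₁, h₂, -⟩ := hs.principal
      exact Prod.ext (le_antisymm h₁ (hs.isGLB.1 (by simp)))
        (le_antisymm h₂ (hs.isGLB.1 (by simp)))
    subst hz
    rw [eq_base hr, hb]
    rw [hb] at hs
    exact eq_base hs ▸ hb ▸ hs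
  -- At `z` the directions agree up to a swap; a swap would be visible at a cover `y' ≤ z`, where
  -- they are known to agree.
  · obtain ⟨y', hy', hyz⟩ := hX.exists_covBy_le d.isBasic_base hz
    obtain ⟨q', hdq⟩ := d.exists_value hy'.le
    have heq := value_of_covBy hX hb hy hy' hq hq' hdq
    have := (value_of_le (e := e.compl) hb hr hs.compl hyz hdq).compl.unique heq
    exfalso
    rcases hdq.eq_of_covBy hy' with rfl | rfl
    · exact hy'.ne' (congrArg Prod.fst this)
    · exact hy'.ne (congrArg Prod.fst this)

end Direction

/-! ### Directions below `t` as elements of a Boolean algebra. -/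

section Representation

open BooleanSubalgebra

variable {X : Type u} [PartialOrder X] {t : X} {B : Type u} [BooleanAlgebra B]
  {φ : Set.Iic t ≃o BooleanSubalgebra B}

/-- The element of `X` below `t` that corresponds to a subalgebra of `B`. -/
def below (φ : Set.Iic t ≃o BooleanSubalgebra B) (S : BooleanSubalgebra B) : X := (φ.symm S : X)

theorem below_le (S : BooleanSubalgebra B) : below φ S ≤ t := (φ.symm S).2

theorem exists_below_eq (φ : Set.Iic t ≃o BooleanSubalgebra B) {x : X} (h : x ≤ t) :
    ∃ S, x = below φ S :=
  ⟨φ ⟨x, h⟩, by rw [below, φ.symm_apply_apply]⟩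

theorem below_le_below {S T : BooleanSubalgebra B} : below φ S ≤ below φ T ↔ S ≤ T :=
  φ.symm.le_iff_le

theorem below_inj {S T : BooleanSubalgebra B} : below φ S = below φ T ↔ S = T :=
  Subtype.coe_inj.trans φ.symm.injective.eq_iff

theorem below_top : below φ ⊤ = t := congrArg Subtype.val φ.symm.map_top

theorem covBy_below {S T : BooleanSubalgebra B} : below φ S ⋖ below φ T ↔ S ⋖ T :=
  covBy_coe_Iic.trans (apply_covBy_apply_iff φ.symm)

theorem isGLB_below {S T U : BooleanSubalgebra B} :
    IsGLB {below φ S, below φ T} (below φ U) ↔ S ⊓ T = U :=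
  isGLB_coe_Iic.trans (φ.symm.isGLB_pair_iff.trans
    ⟨fun h => isGLB_pair.unique h, fun h => h ▸ isGLB_pair⟩)

/-- Only this implication is general: a join in `↓t` need not be a join in `X`, whereas meets in the
two agree. -/
theorem eq_sup_of_isLUB_below {S T U : BooleanSubalgebra B}
    (h : IsLUB {below φ S, below φ T} (below φ U)) : U = S ⊔ T := by
  refine le_antisymm (below_le_below.1 (h.2 ?_)) (sup_le (below_le_below.1 (h.1 (by simp)))
    (below_le_below.1 (h.1 (by simp))))
  simp [upperBounds, below_le_below]

variable [OrderBot X]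

theorem below_bot : below φ ⊥ = ⊥ := congrArg Subtype.val φ.symm.map_bot

theorem isAtom_below {S : BooleanSubalgebra B} : IsAtom (below φ S) ↔ IsAtom S :=
  isAtom_coe_Iic.trans (φ.symm.isAtom_iff S)

theorem isBasic_below {S : BooleanSubalgebra B} : IsBasic (below φ S) ↔ IsBasic S :=
  isBasic_coe_Iic.trans (isBasic_map_iff φ.symm)

theorem isBasic_top_of_isBasic (φ : Set.Iic t ≃o BooleanSubalgebra B) (ht : ¬ IsBasic t) :
    ¬ IsBasic (⊤ : BooleanSubalgebra B) := fun h =>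
  ht (below_top (φ := φ) ▸ isBasic_below.2 h)

/-- The direction `d` is represented by the element `p` of a Boolean algebra whose subalgebras
correspond to the elements below `t`. -/
def Represents (φ : Set.Iic t ≃o BooleanSubalgebra B) (d : Direction X) (p : B) : Prop :=
  d.Value t (below φ (principal p), below φ (principal pᶜ))

namespace Represents

variable {d e f : Direction X} {p q r : B}

theorem base_eq (h : Represents φ d p) : d.base = below φ (closure {p}) :=
  h.isGLB.unique (isGLB_below.2 (principal_inf_principal_compl p))

theorem compl (h : Represents φ d p) : Represents φ d.compl pᶜ := by
  have := Direction.Value.compl h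
  rw [Prod.swap_prod_mk] at this
  rwa [Represents, _root_.compl_compl]

theorem exists_elem (φ : Set.Iic t ≃o BooleanSubalgebra B) (h : d.base ≤ t) :
    ∃ p, Represents φ d p := by
  obtain ⟨⟨x, y⟩, hv⟩ := d.exists_value h
  obtain ⟨h₀, h₁, h₂, hp⟩ := hv.principal
  have hbas : IsBasic (φ ⟨d.base, h₀⟩) :=
    (isBasic_map_iff φ).2 ((isBasic_coe_Iic (x := ⟨d.base, h₀⟩)).1 d.isBasic_base)
  obtain ⟨b, hb⟩ := isBasic_iff.1 hbas
  replace hp := hp.map φ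
  rw [hb] at hp
  have key : ∀ {z : X} (hz : z ≤ t) {S : BooleanSubalgebra B}, φ ⟨z, hz⟩ = S → z = below φ S := by
    rintro z hz S rfl
    rw [below, φ.symm_apply_apply]
  rcases eq_principal_of_isPrincipalPairFor hp with ⟨h₃, h₄⟩ | ⟨h₃, h₄⟩
  · refine ⟨b, ?_⟩
    rw [Represents, ← key h₁ h₃, ← key h₂ h₄]
    exact hv
  · refine ⟨bᶜ, ?_⟩
    rw [Represents, _root_.compl_compl, ← key h₁ h₃, ← key h₂ h₄]
    exact hv

/-- A direction for `closure {p}` represents `p` or `pᶜ`; in the second case its complement is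
taken. -/
theorem exists_direction (φ : Set.Iic t ≃o BooleanSubalgebra B) (hdir : HasEnoughDirections X)
    (p : B) : ∃ d, Represents φ d p := by
  obtain ⟨d, hd⟩ := hdir.2 (below φ (closure {p})) (isBasic_below.2 (isBasic_iff.2 ⟨p, rfl⟩))
  obtain ⟨q, hq⟩ := exists_elem φ (hd ▸ below_le _ : d.base ≤ t)
  have hpq : closure {q} = closure {p} := below_inj.1 (hq.base_eq.symm.trans hd)
  by_cases hbot : closure {p} = ⊥
  · have h₁ := closure_singleton_eq_bot.1 hbot
    have h₂ := closure_singleton_eq_bot.1 (hpq.trans hbot)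
    have : p = q ∨ p = qᶜ := by
      rcases h₁ with rfl | rfl <;> rcases h₂ with rfl | rfl <;> simp
    rcases this with rfl | rfl
    exacts [⟨d, hq⟩, ⟨d.compl, hq.compl⟩]
  · have hp : p ∈ closure {q} := hpq ▸ mem_closure_self p
    rcases mem_closure_singleton.1 hp with h | h | rfl | rfl
    · exact absurd (closure_singleton_eq_bot.2 (Or.inl h)) hbot
    · exact absurd (closure_singleton_eq_bot.2 (Or.inr h)) hbot
    · exact ⟨d, hq⟩
    · exact ⟨d.compl, hq.compl⟩

theorem elem_unique (ht : ¬ IsBasic t) (h : Represents φ d p) (h' : Represents φ d q) :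
    p = q := by
  have := Direction.Value.unique h h'
  exact eq_of_principal_eq (isBasic_top_of_isBasic φ ht) (below_inj.1 (congrArg Prod.fst this))
    (below_inj.1 (congrArg Prod.snd this))

theorem direction_unique (hX : IsOrthodomain X) (ht : ¬ IsBasic t) (h : Represents φ d p)
    (h' : Represents φ e p) : d = e :=
  Direction.eq_of_value hX (h.base_eq.trans h'.base_eq.symm)
    (lt_of_le_of_ne h.base_le fun heq => ht (heq ▸ d.isBasic_base)) h h'

theorem zero (φ : Set.Iic t ≃o BooleanSubalgebra B) : Represents φ Direction.zero ⊥ := by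
  refine ⟨bot_le, ?_⟩
  rw [compl_bot, principal_bot, principal_top, below_bot, below_top]
  rfl

theorem one (φ : Set.Iic t ≃o BooleanSubalgebra B) : Represents φ Direction.one ⊤ := by
  refine ⟨bot_le, ?_⟩
  rw [compl_top, principal_bot, principal_top, below_bot, below_top]
  rfl

theorem value (h : Represents φ d p) {W : BooleanSubalgebra B} (hp : p ∈ W) :
    d.Value (below φ W) (below φ (W ⊓ principal p), below φ (W ⊓ principal pᶜ)) := by
  obtain ⟨⟨x, y⟩, hv⟩ := d.exists_value
    (h.base_eq ▸ below_le_below.2 (closure_le_of_mem hp) : d.base ≤ below φ W)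
  obtain ⟨h₁, h₂⟩ := Direction.Value.restrict h hv (below_le W)
  have e₁ := h₁.unique (isGLB_below.2 rfl)
  have e₂ := h₂.unique (isGLB_below.2 rfl)
  dsimp only at e₁ e₂
  rwa [← e₁, ← e₂]

/-- The value of `d` at `w` says `W ≤ principal pᶜ`, so `q ≤ pᶜ` or `p ≤ q`. The value of `e` says
`W ⊓ principal q = closure {q}`, which excludes `p ≤ q` because the bases differ. -/
theorem exists_eq_of_nearAt (hp : Represents φ d p) (hq : Represents φ e q) {w : X}
    (h : d.NearAt e w) :
    w = below φ (closure {p} ⊔ closure {q}) ∧ p ≠ ⊥ ∧ q ≠ ⊥ ∧ Disjoint p q ∧ p ⊔ q ≠ ⊤ := by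
  obtain ⟨⟨ha, hb, hne, hlub, -, -⟩, hd, he⟩ := h
  have hwt : w ≤ t := hlub.2 (by simp [upperBounds, hp.base_le, hq.base_le])
  obtain ⟨W, rfl⟩ := exists_below_eq φ hwt
  rw [hp.base_eq] at ha hne hlub hd
  rw [hq.base_eq] at hb hne hlub he
  obtain rfl := eq_sup_of_isLUB_below hlub
  have hpW := mem_sup_left p q
  have hqW := mem_sup_right p q
  have hd' := (hp.value hpW).unique hd
  have he' := (hq.value hqW).unique he
  have hWp : closure {p} ⊔ closure {q} ≤ principal pᶜ :=
    inf_eq_left.1 (below_inj.1 (congrArg Prod.snd hd'))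
  have hWq : (closure {p} ⊔ closure {q}) ⊓ principal q = closure {q} :=
    below_inj.1 (congrArg Prod.fst he')
  have ha' : closure {p} ≠ ⊥ := (isAtom_below.1 ha).1
  have hb' : closure {q} ≠ ⊥ := (isAtom_below.1 hb).1
  have hne' : closure {p} ≠ closure {q} := fun h => hne (h ▸ rfl)
  refine ⟨rfl, fun h => ha' (closure_singleton_eq_bot.2 (Or.inl h)),
    fun h => hb' (closure_singleton_eq_bot.2 (Or.inl h)), ?_, ?_⟩
  · rcases mem_principal_compl.1 (hWp hqW) with h | h
    · exact le_compl_iff_disjoint_left.1 h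
    · exact absurd (closure_singleton_eq ha' (hWq.le ⟨hpW, Or.inl h⟩)) hne'
  · intro htop
    rcases mem_principal_compl.1 (hWp hqW) with h | h
    · have : q = pᶜ := le_antisymm h <| by
        rw [← top_inf_eq pᶜ, ← htop, inf_sup_right, inf_compl_eq_bot, bot_sup_eq]
        exact inf_le_left
      exact hne' (by rw [this, BooleanSubalgebra.closure_compl])
    · exact absurd (closure_singleton_eq ha' (hWq.le ⟨hpW, Or.inl h⟩)) hne'

theorem nearAt (hX : IsOrthodomain X) (hd : Represents φ d p) (he : Represents φ e q) (hp : p ≠ ⊥)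
    (hq : q ≠ ⊥) (hpq : Disjoint p q) (htop : p ⊔ q ≠ ⊤) :
    d.NearAt e (below φ (closure {p} ⊔ closure {q})) := by
  have htop' : q ⊔ p ≠ ⊤ := sup_comm p q ▸ htop
  have hcp := closure_covBy_sup hp hq hpq htop
  have hcq := closure_covBy_sup hq hp hpq.symm htop'
  rw [sup_comm] at hcq
  have ha : IsAtom (closure {p}) :=
    (isBasic_iff.2 ⟨p, rfl⟩).resolve_left (closure_ne_bot hp htop)
  have hb : IsAtom (closure {q}) :=
    (isBasic_iff.2 ⟨q, rfl⟩).resolve_left (closure_ne_bot hq htop')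
  have hne : below φ (closure {p}) ≠ below φ (closure {q}) := fun h =>
    closure_ne_closure hp hq hpq htop (below_inj.1 h)
  have hWp := sup_le_principal_compl hpq
  have hWq := sup_le_principal_compl hpq.symm
  rw [sup_comm] at hWq
  have hd' := hd.value (mem_sup_left p q)
  have he' := he.value (mem_sup_right p q)
  rw [inf_principal_eq (mem_sup_left p q) hWp, inf_eq_left.2 hWp] at hd'
  rw [inf_principal_eq (mem_sup_right p q) hWq, inf_eq_left.2 hWq] at he'
  rw [Direction.NearAt, IsNearWithJoin, hd.base_eq, he.base_eq]
  exact ⟨⟨isAtom_below.2 ha, isAtom_below.2 hb, hne,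
    -- The orthodomain axiom on covers turns the join inside `↓t` into a join in `X`.
    hX.isLUB_of_covBy _ _ _ (isAtom_below.2 ha) (isAtom_below.2 hb) hne (covBy_below.2 hcp)
      (covBy_below.2 hcq), covBy_below.2 hcp, covBy_below.2 hcq⟩, hd', he'⟩

theorem isSum_iff (hX : IsOrthodomain X) (ht : ¬ IsBasic t) (hd : Represents φ d p)
    (he : Represents φ e q) (hf : Represents φ f r) :
    d.IsSum e f ↔ Disjoint p q ∧ p ⊔ q = r := by
  constructor
  · rintro (⟨rfl, rfl⟩ | ⟨rfl, rfl⟩ | ⟨rfl, rfl⟩ | ⟨w, z, hnear, hz, rfl, hfw⟩)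
    · obtain rfl := elem_unique ht he (zero φ)
      obtain rfl := elem_unique ht hd hf
      simp
    · obtain rfl := elem_unique ht hd (zero φ)
      obtain rfl := elem_unique ht he hf
      simp
    · obtain rfl := elem_unique ht he hd.compl
      obtain rfl := elem_unique ht hf (one φ)
      exact ⟨disjoint_compl_right, sup_compl_eq_top⟩
    · obtain ⟨rfl, hp, hq, hpq, htop⟩ := exists_eq_of_nearAt hd he hnear
      refine ⟨hpq, ?_⟩
      obtain ⟨hza, hzd, hze, hzw⟩ := hz
      rw [hf.base_eq] at hza hzd hze hzw hfw
      rw [hd.base_eq, Ne, below_inj] at hzd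
      rw [he.base_eq, Ne, below_inj] at hze
      have hr : closure {r} ≠ ⊥ := (isAtom_below.1 hza).1
      have hrW := below_le_below.1 hzw (mem_closure_self r)
      have hval := (hf.value hrW).unique hfw
      have hWr : closure {p} ⊔ closure {q} ≤ principal r :=
        inf_eq_left.1 (below_inj.1 (congrArg Prod.fst hval))
      -- Were `rᶜ ≤ s`, then `r` would lie in `W ⊓ principal s = closure {s}`, against `z` being a
      -- third atom.
      have aux : ∀ s : B, s ∈ principal r → closure {r} ≠ closure {s} →
          closure {p} ⊔ closure {q} ≤ principal sᶜ → s ∈ closure {p} ⊔ closure {q} → s ≤ r := by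
        intro s hs hne hW hsW
        refine hs.resolve_right fun h => hne ?_
        refine closure_singleton_eq hr ?_
        rw [← inf_principal_eq hsW hW]
        exact ⟨hrW, Or.inr (compl_le_iff_compl_le.1 h)⟩
      have hpr : p ≤ r := aux p (hWr (mem_sup_left p q)) hzd (sup_le_principal_compl hpq)
        (mem_sup_left p q)
      have hqr : q ≤ r := aux q (hWr (mem_sup_right p q)) hze
        (sup_comm (closure {p}) (closure {q}) ▸ sup_le_principal_compl hpq.symm)
        (mem_sup_right p q)
      refine le_antisymm (sup_le hpr hqr) ((sup_le_principal_sup p q hrW).resolve_right fun h => ?_)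
      refine hr (closure_singleton_eq_bot.2 (Or.inr (top_le_iff.1 ?_)))
      rw [← sup_compl_eq_top (x := p ⊔ q)]
      exact sup_le (sup_le hpr hqr) h
  · rintro ⟨hpq, rfl⟩
    -- The clauses of the sum match the cases `p = ⊥`, `q = ⊥`, `p ⊔ q = ⊤`, and the remaining one,
    -- where the third atom is `closure {p ⊔ q}`.
    by_cases hp : p = ⊥
    · subst hp
      rw [bot_sup_eq] at hf
      exact Or.inr (Or.inl ⟨direction_unique hX ht hd (zero φ), direction_unique hX ht hf he⟩)
    by_cases hq : q = ⊥
    · subst hq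
      rw [sup_bot_eq] at hf
      exact Or.inl ⟨direction_unique hX ht he (zero φ), direction_unique hX ht hf hd⟩
    by_cases htop : p ⊔ q = ⊤
    · have : q = pᶜ := (IsCompl.of_eq hpq.eq_bot htop).compl_eq.symm
      subst this
      rw [htop] at hf
      exact Or.inr (Or.inr (Or.inl ⟨direction_unique hX ht he hd.compl,
        direction_unique hX ht hf (one φ)⟩))
    have hrW := sup_mem (mem_sup_left p q) (mem_sup_right p q)
    have hval := hf.value hrW
    have hW := sup_le_principal_sup p q
    rw [inf_eq_left.2 hW, inf_principal_eq (compl_mem hrW) (by rwa [_root_.compl_compl]),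
      BooleanSubalgebra.closure_compl] at hval
    refine Or.inr (Or.inr (Or.inr ⟨_, _, nearAt hX hd he hp hq hpq htop, ?_, hf.base_eq, hval⟩))
    have hne : p ⊔ q ≠ ⊥ := fun h => hp (sup_eq_bot_iff.1 h).1
    have hbot : closure {p ⊔ q} ≠ ⊥ := by
      rw [Ne, closure_singleton_eq_bot]
      exact fun h => h.elim hne htop
    have aux : ∀ s s' : B, s ≠ ⊥ → s' ≠ ⊥ → Disjoint s s' → s ⊔ s' ≠ ⊤ →
        below φ (closure {s ⊔ s'}) ≠ below φ (closure {s}) := by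
      intro s s' hs hs' hdis hst h
      have hmem : s ⊔ s' ∈ closure {s} := below_inj.1 h ▸ mem_closure_self _
      rcases mem_closure_singleton.1 hmem with h | h | h | h
      · exact hs (sup_eq_bot_iff.1 h).1
      · exact hst h
      · exact hs' (le_bot_iff.1 (hdis (sup_eq_left.1 h) le_rfl))
      · refine hs (le_bot_iff.1 ?_)
        rw [← inf_compl_eq_bot (a := s), ← h]
        exact le_inf le_rfl le_sup_left
    refine ⟨isAtom_below.2 ((isBasic_iff.2 ⟨_, rfl⟩).resolve_left hbot), ?_, ?_,
      below_le_below.2 (closure_le_of_mem hrW)⟩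
    · rw [hd.base_eq]
      exact aux p q hp hq hpq htop
    · rw [he.base_eq, sup_comm]
      exact aux q p hq hp hpq.symm (sup_comm p q ▸ htop)

end Represents

end Representation

/-! ### The orthoalgebra of directions. -/

namespace Direction

variable {X : Type u} [PartialOrder X] [OrderBot X] {d e f g a b c s v : Direction X}

theorem not_isBasic_of_isAtom_lt {x w : X} (hx : IsAtom x) (h : x < w) : ¬ IsBasic w := by
  rintro (rfl | hw)
  · exact not_lt_bot h
  · exact hx.1 (hw.2 x h)

theorem NearAt.not_isBasic {w : X} (h : NearAt d e w) : ¬ IsBasic w :=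
  not_isBasic_of_isAtom_lt h.1.1 h.1.2.2.2.2.1.lt

theorem NearAt.not_isBasic_of_le {w t : X} (h : NearAt d e w) (hwt : w ≤ t) : ¬ IsBasic t :=
  not_isBasic_of_isAtom_lt h.1.1 (h.1.2.2.2.2.1.lt.trans_le hwt)

theorem NearAt.symm {w : X} (h : NearAt d e w) : NearAt e d w := by
  obtain ⟨⟨h₁, h₂, h₃, h₄, h₅, h₆⟩, h₇, h₈⟩ := h
  exact ⟨⟨h₂, h₁, h₃.symm, Set.pair_comm d.base e.base ▸ h₄, h₆, h₅⟩, h₈, h₇⟩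

theorem IsSum.symm (h : IsSum d e f) : IsSum e d f := by
  rcases h with h | h | ⟨rfl, h⟩ | ⟨w, z, h₁, ⟨h₂, h₃, h₄, h₅⟩, h₆⟩
  · exact Or.inr (Or.inl h)
  · exact Or.inl h
  · exact Or.inr (Or.inr (Or.inl ⟨rfl, h⟩))
  · exact Or.inr (Or.inr (Or.inr ⟨w, z, h₁.symm, ⟨h₂, h₄, h₃, h₅⟩, h₆⟩))

theorem compl_zero : (zero : Direction X).compl = one := rfl

theorem compl_one : (one : Direction X).compl = zero := rfl

theorem exists_le_not_isBasic (hX : IsOrthodomain X) (hdir : HasEnoughDirections X) {x : X}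
    (hx : IsBasic x) : ∃ t, x ≤ t ∧ ¬ IsBasic t := by
  obtain ⟨y, hxy, hy⟩ : ∃ y, x ≤ y ∧ IsAtom y := by
    rcases hx with rfl | hx
    · obtain ⟨w, hw⟩ := not_isMax_iff.1 (hdir.1 ⊥ (Or.inl rfl))
      obtain ⟨y, hy, -⟩ := hX.exists_covBy_le (Or.inl rfl) hw
      exact ⟨y, bot_le, bot_covBy_iff.1 hy⟩
    · exact ⟨x, le_rfl, hx⟩
  obtain ⟨t, ht⟩ := not_isMax_iff.1 (hdir.1 y (Or.inr hy))
  exact ⟨t, hxy.trans ht.le, not_isBasic_of_isAtom_lt hy ht⟩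

theorem zero_ne_one (hX : IsOrthodomain X) (hdir : HasEnoughDirections X) :
    (zero : Direction X) ≠ one := by
  intro h
  obtain ⟨t, -, ht⟩ := exists_le_not_isBasic hX hdir (x := ⊥) (Or.inl rfl)
  have h₁ : (zero : Direction X).Value t (⊥, t) := ⟨bot_le, rfl⟩
  have h₂ : (one : Direction X).Value t (t, ⊥) := ⟨bot_le, rfl⟩
  rw [h] at h₁
  exact ht (Or.inl (congrArg Prod.fst (h₂.unique h₁)))

theorem compl_ne_self (hX : IsOrthodomain X) (hdir : HasEnoughDirections X) (d : Direction X) :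
    d.compl ≠ d := by
  intro h
  obtain ⟨w, hw⟩ := not_isMax_iff.1 (hdir.1 _ d.isBasic_base)
  obtain ⟨y, hy, -⟩ := hX.exists_covBy_le d.isBasic_base hw
  obtain ⟨p, hp⟩ := d.exists_value hy.le
  have hp' := hp.compl
  rw [h] at hp'
  have := hp'.unique hp
  rcases hp.eq_of_covBy hy with rfl | rfl
  · exact hy.ne' (congrArg Prod.fst this)
  · exact hy.ne (congrArg Prod.fst this)

theorem IsSum.unique (hX : IsOrthodomain X) (hf : IsSum d e f) (hg : IsSum d e g) : f = g := by
  have near_zero_left : ∀ {e : Direction X} {w}, ¬ NearAt zero e w := fun h => h.1.1.1 rfl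
  have near_zero_right : ∀ {d : Direction X} {w}, ¬ NearAt d zero w := fun h => h.1.2.1.1 rfl
  have near_compl : ∀ {d : Direction X} {w}, ¬ NearAt d d.compl w := fun h => h.1.2.2.1 rfl
  rcases hf with ⟨rfl, rfl⟩ | ⟨rfl, rfl⟩ | ⟨rfl, rfl⟩ | ⟨w, z, hn, hz, hb, hv⟩ <;>
  rcases hg with ⟨h₁, rfl⟩ | ⟨h₁, rfl⟩ | ⟨h₁, rfl⟩ | ⟨w', z', hn', hz', hb', hv'⟩
  · rfl
  · exact h₁
  · rw [← compl_compl f, ← h₁, compl_zero]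
  · exact absurd hn' near_zero_right
  · exact h₁
  · rfl
  · exact h₁
  · exact absurd hn' near_zero_left
  · rw [← compl_compl g, h₁, compl_zero]
  · exact h₁.symm ▸ rfl
  · rfl
  · exact absurd hn' near_compl
  · exact absurd hn (h₁ ▸ near_zero_right)
  · exact absurd hn (h₁ ▸ near_zero_left)
  · exact absurd hn (h₁ ▸ near_compl)
  · obtain rfl := hn.1.2.2.2.1.unique hn'.1.2.2.2.1
    obtain ⟨B, _, ⟨φ⟩⟩ := hX.booleanDomain_Iic w
    have ht := hn.not_isBasic
    obtain ⟨p, hp⟩ := Represents.exists_elem φ hn.2.1.base_le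
    obtain ⟨q, hq⟩ := Represents.exists_elem φ hn.2.2.base_le
    obtain ⟨r, hr⟩ := Represents.exists_elem φ hv.base_le
    obtain ⟨r', hr'⟩ := Represents.exists_elem φ hv'.base_le
    obtain ⟨-, rfl⟩ := (hp.isSum_iff hX ht hq hr).1
      (Or.inr (Or.inr (Or.inr ⟨w, z, hn, hz, hb, hv⟩)))
    obtain ⟨-, rfl⟩ := (hp.isSum_iff hX ht hq hr').1
      (Or.inr (Or.inr (Or.inr ⟨w, z', hn', hz', hb', hv'⟩)))
    exact hr.direction_unique hX ht hr'

theorem exists_isSum_iff (hX : IsOrthodomain X) (hdir : HasEnoughDirections X) :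
    (∃ f, IsSum d e f) ↔ Orthogonal d e := by
  constructor
  · rintro ⟨f, ⟨h, -⟩ | ⟨h, -⟩ | ⟨h, -⟩ | ⟨w, z, h, -⟩⟩
    · exact Or.inr (Or.inl h)
    · exact Or.inl h
    · exact Or.inr (Or.inr (Or.inl h))
    · exact Or.inr (Or.inr (Or.inr ⟨w, h⟩))
  · rintro (h | h | h | ⟨w, hn⟩)
    · exact ⟨e, Or.inr (Or.inl ⟨h, rfl⟩)⟩
    · exact ⟨d, Or.inl ⟨h, rfl⟩⟩
    · exact ⟨one, Or.inr (Or.inr (Or.inl ⟨h, rfl⟩))⟩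
    · obtain ⟨B, _, ⟨φ⟩⟩ := hX.booleanDomain_Iic w
      obtain ⟨p, hp⟩ := Represents.exists_elem φ hn.2.1.base_le
      obtain ⟨q, hq⟩ := Represents.exists_elem φ hn.2.2.base_le
      obtain ⟨f, hf⟩ := Represents.exists_direction φ hdir (p ⊔ q)
      exact ⟨f, (hp.isSum_iff hX hn.not_isBasic hq hf).2
        ⟨(hp.exists_eq_of_nearAt hq hn).2.2.2.1, rfl⟩⟩

/-- Nearness gives covers only for the two summands; condition (3), applied to the sum in the proof
of associativity, needs the third atom covered too. -/
theorem base_covBy_of_isThirdAtom (hX : IsOrthodomain X) {w z : X} (hn : NearAt d e w)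
    (hz : IsThirdAtom d.base e.base w z) (hb : f.base = z) (hv : f.Value w (w, z)) : z ⋖ w := by
  obtain ⟨B, _, ⟨φ⟩⟩ := hX.booleanDomain_Iic w
  obtain ⟨p, hp⟩ := Represents.exists_elem φ hn.2.1.base_le
  obtain ⟨q, hq⟩ := Represents.exists_elem φ hn.2.2.base_le
  obtain ⟨r, hr⟩ := Represents.exists_elem φ hv.base_le
  obtain ⟨-, rfl⟩ := (hp.isSum_iff hX hn.not_isBasic hq hr).1
    (Or.inr (Or.inr (Or.inr ⟨w, z, hn, hz, hb, hv⟩)))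
  obtain ⟨hw, h₁, h₂, h₃, h₄⟩ := hp.exists_eq_of_nearAt hq hn
  rw [← hb, hr.base_eq]
  have hcov := covBy_below (φ := φ).2 (BooleanSubalgebra.closure_sup_covBy_sup h₁ h₂ h₃ h₄)
  rwa [← hw] at hcov

theorem IsSum.assoc_below (hX : IsOrthodomain X) (hdir : HasEnoughDirections X) {t : X}
    (ht : ¬ IsBasic t) (ha : a.base ≤ t) (hb : b.base ≤ t) (hc : c.base ≤ t) (hs : s.base ≤ t)
    (hf : f.base ≤ t) (h₁ : IsSum a b s) (h₂ : IsSum s c f) :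
    ∃ v, IsSum b c v ∧ IsSum a v f := by
  obtain ⟨B, _, ⟨φ⟩⟩ := hX.booleanDomain_Iic t
  obtain ⟨p, hp⟩ := Represents.exists_elem φ ha
  obtain ⟨q, hq⟩ := Represents.exists_elem φ hb
  obtain ⟨r, hr⟩ := Represents.exists_elem φ hc
  obtain ⟨x, hx⟩ := Represents.exists_elem φ hs
  obtain ⟨y, hy⟩ := Represents.exists_elem φ hf
  obtain ⟨hpq, rfl⟩ := (hp.isSum_iff hX ht hq hx).1 h₁
  obtain ⟨hxr, rfl⟩ := (hx.isSum_iff hX ht hr hy).1 h₂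
  obtain ⟨v, hv⟩ := Represents.exists_direction φ hdir (q ⊔ r)
  rw [disjoint_sup_left] at hxr
  exact ⟨v, (hq.isSum_iff hX ht hr hv).2 ⟨hxr.2, rfl⟩,
    (hp.isSum_iff hX ht hv hy).2 ⟨disjoint_sup_right.2 ⟨hpq, hxr.1⟩, (sup_assoc _ _ _).symm⟩⟩

theorem IsSum.assoc (hX : IsOrthodomain X) (hdir : HasEnoughDirections X)
    (h₁ : IsSum a b s) (h₂ : IsSum s c f) : ∃ v, IsSum b c v ∧ IsSum a v f := by
  have h₁' := h₁
  have h₂' := h₂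
  rcases h₁ with ⟨rfl, rfl⟩ | ⟨rfl, rfl⟩ | ⟨rfl, rfl⟩ | ⟨w, z, hn, hz, hb, hv⟩
  · exact ⟨c, Or.inr (Or.inl ⟨rfl, rfl⟩), h₂⟩
  · exact ⟨f, h₂, Or.inr (Or.inl ⟨rfl, rfl⟩)⟩
  · obtain ⟨rfl, rfl⟩ : c = zero ∧ f = one := by
      rcases h₂ with ⟨h, h'⟩ | ⟨h, h'⟩ | ⟨h, h'⟩ | ⟨w, z, hn, -⟩
      · exact ⟨h, h'⟩
      · exact absurd h.symm (zero_ne_one hX hdir)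
      · exact ⟨h, h'⟩
      · exact absurd rfl hn.1.1.1
    exact ⟨a.compl, Or.inl ⟨rfl, rfl⟩, Or.inr (Or.inr (Or.inl ⟨rfl, rfl⟩))⟩
  · have hlub := hn.1.2.2.2.1
    have ha : a.base ≤ w := hn.2.1.base_le
    have hb' : b.base ≤ w := hn.2.2.base_le
    have hs : s.base ≤ w := hv.base_le
    rcases h₂ with ⟨rfl, rfl⟩ | ⟨rfl, rfl⟩ | ⟨rfl, rfl⟩ | ⟨w', z', hn', hz', hf, hv'⟩
    · exact ⟨b, Or.inl ⟨rfl, rfl⟩, h₁'⟩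
    · exact absurd hb.symm hz.1.1
    · exact IsSum.assoc_below hX hdir hn.not_isBasic ha hb' hs hs bot_le h₁' h₂'
    · have hcov : s.base ⋖ w := hb ▸ base_covBy_of_isThirdAtom hX hn hz hb hv
      have hcov' : s.base ⋖ w' := hn'.1.2.2.2.2.1
      -- As a sum, `s` has value `(w, s.base)` at `w`; as a summand it has value `(s.base, w')` at
      -- `w'`. Condition (3) thus yields `t` covering both, and every base involved lies below `t`.
      obtain ⟨t, -, hwt, hwt'⟩ := s.exists_join ⟨w', hcov'.le⟩ ⟨w, hcov.le⟩ hcov' hcov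
        hn'.2.1.2 (hb ▸ hv.2)
      exact IsSum.assoc_below hX hdir (hn.not_isBasic_of_le hwt'.le) (ha.trans hwt'.le)
        (hb'.trans hwt'.le) (hn'.2.2.base_le.trans hwt.le) (hs.trans hwt'.le)
        (hv'.base_le.trans hwt.le) h₁' h₂'

theorem IsSum.eq_compl (h : IsSum d e one) : e = d.compl := by
  rcases h with ⟨rfl, rfl⟩ | ⟨rfl, rfl⟩ | ⟨h, -⟩ | ⟨w, z, -, hz, hb, -⟩
  · exact compl_one.symm
  · exact compl_zero.symm
  · exact h
  · exact absurd hb.symm hz.1.1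

theorem isSum_self_iff (hX : IsOrthodomain X) (hdir : HasEnoughDirections X) :
    (∃ f, IsSum d d f) ↔ d = zero := by
  constructor
  · rintro ⟨f, ⟨h, -⟩ | ⟨h, -⟩ | ⟨h, -⟩ | ⟨w, z, hn, -⟩⟩
    · exact h
    · exact h
    · exact absurd h.symm (compl_ne_self hX hdir d)
    · exact absurd rfl hn.1.2.2.1
  · exact fun h => ⟨d, Or.inl ⟨h, rfl⟩⟩

/-- The partial sum of directions. -/
noncomputable def oplus (d e : Direction X) : Part (Direction X) :=
  ⟨∃ f, IsSum d e f, fun h => h.choose⟩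

theorem mem_oplus (hX : IsOrthodomain X) : f ∈ oplus d e ↔ IsSum d e f :=
  ⟨fun ⟨h, hf⟩ => hf ▸ h.choose_spec, fun h => ⟨⟨f, h⟩, (Exists.choose_spec ⟨f, h⟩).unique hX h⟩⟩

/-- The orthoalgebra of directions. -/
noncomputable def orthoalgebra (hX : IsOrthodomain X) (hdir : HasEnoughDirections X) :
    Orthoalgebra (Direction X) where
  oplus := oplus
  compl := compl
  zero := zero
  one := one
  oplus_comm d e := Part.ext fun f => by
    rw [mem_oplus hX, mem_oplus hX]
    exact ⟨IsSum.symm, IsSum.symm⟩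
  oplus_assoc a b c := Part.ext fun f => by
    simp only [Part.mem_bind_iff, mem_oplus hX]
    constructor
    · rintro ⟨s, h₁, h₂⟩
      exact h₁.assoc hX hdir h₂
    · rintro ⟨s, h₁, h₂⟩
      obtain ⟨v, h₃, h₄⟩ := h₁.symm.assoc hX hdir h₂.symm
      exact ⟨v, h₃.symm, h₄.symm⟩
  oplus_compl d := (mem_oplus hX).2 (Or.inr (Or.inr (Or.inl ⟨rfl, rfl⟩)))
  eq_compl _ _ h := ((mem_oplus hX).1 h).eq_compl
  oplus_self_dom _ := isSum_self_iff hX hdir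

/-- The directions with base below a nonbasic element form a Boolean subalgebra. -/
theorem isBooleanSubalgebra_setOf_base_le (hX : IsOrthodomain X) (hdir : HasEnoughDirections X)
    {t : X} (ht : ¬ IsBasic t) :
    (orthoalgebra hX hdir).IsBooleanSubalgebra {d | d.base ≤ t} := by
  obtain ⟨B, _, ⟨φ⟩⟩ := hX.booleanDomain_Iic t
  choose dir hdir' using Represents.exists_direction φ hdir
  have hle : ∀ p, (dir p).base ≤ t := fun p => (hdir' p).base_le
  have hrep : ∀ {d : Direction X} {p : B}, Represents φ d p → d = dir p := fun h =>
    h.direction_unique hX ht (hdir' _)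
  let ψ : B ≃ {d : Direction X | d.base ≤ t} := Equiv.ofBijective (fun p => ⟨dir p, hle p⟩)
    ⟨fun p q h => (hdir' p).elem_unique ht (by
        have : dir p = dir q := congrArg Subtype.val h
        rw [this]; exact hdir' q),
      fun d => by
        obtain ⟨p, hp⟩ := Represents.exists_elem φ d.2
        exact ⟨p, Subtype.ext (hrep hp).symm⟩⟩
  refine ⟨⟨bot_le, bot_le, fun a ha => ha, ?_⟩, ?_⟩
  · intro a ha b hb c hc
    replace hc : IsSum a b c := (mem_oplus hX).1 hc
    obtain ⟨p, hp⟩ := Represents.exists_elem φ ha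
    obtain ⟨q, hq⟩ := Represents.exists_elem φ hb
    rcases hc with ⟨-, rfl⟩ | ⟨-, rfl⟩ | ⟨-, rfl⟩ | ⟨w, z, hn, -, -, hv⟩
    · exact ha
    · exact hb
    · exact bot_le
    · exact hv.base_le.trans ((hp.exists_eq_of_nearAt hq hn).1 ▸ below_le _)
  · have hψ : ∀ a : {d : Direction X | d.base ≤ t}, Represents φ (a : Direction X) (ψ.symm a) := fun a => by
      obtain ⟨p, rfl⟩ := ψ.surjective a
      rw [ψ.symm_apply_apply]
      exact hdir' p
    refine ⟨ψ.symm.booleanAlgebra, (hrep (Represents.zero φ)).symm,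
      (hrep (Represents.one φ)).symm, fun a => (hrep (hψ a).compl).symm, fun a b c => ?_⟩
    let := ψ.symm.booleanAlgebra
    refine (mem_oplus hX).trans (((hψ a).isSum_iff hX ht (hψ b) (hψ c)).trans ?_)
    refine and_congr ?_ ?_
    · rw [disjoint_iff, disjoint_iff]
      exact (ψ.apply_eq_iff_eq).symm
    · exact ψ.eq_symm_apply

theorem isProper_orthoalgebra (hX : IsOrthodomain X) (hdir : HasEnoughDirections X) :
    (orthoalgebra hX hdir).IsProper := by
  intro S hS hcard
  -- Two distinct nonbottom bases would give five distinct members: `0`, `1`, `d`, `d'` and `e`.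
  obtain ⟨x, hx, hSx⟩ : ∃ x : X, IsBasic x ∧ ∀ d ∈ S, d.base = ⊥ ∨ d.base = x := by
    by_contra! hcon
    obtain ⟨d, hd, hd₀, -⟩ := hcon ⊥ (Or.inl rfl)
    obtain ⟨e, he, he₀, hed⟩ := hcon d.base d.isBasic_base
    have hsub := hS.prop.1
    have hd' : d.compl ∈ S := hsub.compl_mem d hd
    have h₀ : (zero : Direction X) ∈ S := hsub.zero_mem
    have h₁ : (one : Direction X) ∈ S := hsub.one_mem
    have hne := compl_ne_self hX hdir d
    have h5 : ({zero, one, d, d.compl, e} : Set (Direction X)).encard = 5 := by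
      have base_ne : ∀ {a b : Direction X}, a.base ≠ b.base → a ≠ b := fun h h' => h (h' ▸ rfl)
      rw [Set.encard_insert_of_notMem, Set.encard_insert_of_notMem, Set.encard_insert_of_notMem,
        Set.encard_insert_of_notMem, Set.encard_singleton]
      · norm_num
      · exact base_ne (fun h => hed h.symm)
      · simp only [Set.mem_insert_iff, Set.mem_singleton_iff, not_or]
        exact ⟨hne.symm, base_ne fun h => hed h.symm⟩
      · simp only [Set.mem_insert_iff, Set.mem_singleton_iff, not_or]
        exact ⟨base_ne fun h => hd₀ h.symm, base_ne fun h => hd₀ h.symm,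
          base_ne fun h => he₀ h.symm⟩
      · simp only [Set.mem_insert_iff, Set.mem_singleton_iff, not_or]
        exact ⟨zero_ne_one hX hdir, base_ne fun h => hd₀ h.symm, base_ne fun h => hd₀ h.symm,
          base_ne fun h => he₀ h.symm⟩
    have hsubset : ({zero, one, d, d.compl, e} : Set (Direction X)) ⊆ S := by
      simp [Set.insert_subset_iff, *]
    have := (Set.encard_le_encard hsubset).trans hcard
    rw [h5] at this
    exact absurd this (by norm_num)
  obtain ⟨t, hxt, ht⟩ := exists_le_not_isBasic hX hdir hx
  have hle : {d : Direction X | d.base ≤ t} ⊆ S :=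
    hS.le_of_ge (isBooleanSubalgebra_setOf_base_le hX hdir ht) fun d hd => by
      rcases hSx d hd with h | h
      · exact h.trans_le bot_le
      · exact h.trans_le hxt
  -- Each atom below `t` is the base of a direction, which now lies in `S`, so the atom is `x`.
  -- Hence `t ≤ x`.
  obtain ⟨A, hA, hAt⟩ := hX.atomistic.isLUB_atoms t
  have hub : t ≤ x := hA.2 fun a ha => by
    obtain ⟨d, hd⟩ := hdir.2 a (Or.inr (hAt a ha))
    rcases hSx d (hle (hd.trans_le (hA.1 ha))) with h | h
    · exact (hd.symm.trans h).trans_le bot_le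
    · exact (hd.symm.trans h).le
  exact ht (le_antisymm hub hxt ▸ hx)

end Direction

/-- For an orthodomain with enough directions, the clauses defining the partial sum of directions
determine a well-defined partial operation with the prescribed domain, and with it, complement,
`0` and `1` the set of directions is a proper orthoalgebra. -/
theorem mainTheorem5 {X : Type u} [PartialOrder X] [OrderBot X]
    (hX : IsOrthodomain X) (hdir : HasEnoughDirections X) :
    ∃ O : Orthoalgebra (Direction X),
      (∀ d e : Direction X, (O.oplus d e).Dom ↔ d.Orthogonal e) ∧
      (∀ d e f : Direction X, f ∈ O.oplus d e ↔ d.IsSum e f) ∧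
      (∀ d : Direction X, O.compl d = d.compl) ∧
      O.zero = Direction.zero ∧
      O.one = Direction.one ∧
      O.IsProper :=
  ⟨Direction.orthoalgebra hX hdir, fun _ _ => Direction.exists_isSum_iff hX hdir,
    fun _ _ _ => Direction.mem_oplus hX, fun _ => rfl, rfl, rfl,
    Direction.isProper_orthoalgebra hX hdir⟩
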